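/- **Theorem 1.** For $x\in\mathbb{R}$ let $$\varphi_1(x)=\frac{1}{\pi(x^2+1)},\qquad \varphi_2(x)=\frac{1}{(4\pi)^{1/2}}e^{-x^2/4},\qquad \varphi_3^{\alpha}(x)=C^{\alpha}\,\frac{1}{(x^2+1)^{(2-\alpha)/2}}\quad(0<\alpha<1)$$ be the Poisson kernel, the heat kernel and the fractional Poisson kernel on the line, where $C^\alpha>0$ is the constant for which $\int_{\mathbb{R}}\varphi_3^\alpha=1$. Let $\phi$ be $\varphi_1$, or $\varphi_2$, or $\varphi_3^\alpha$ for some $\alpha\in(0,1)$. For $t>0$ put $\phi_t(x)=\frac1t\phi\left(\frac xt\right)$, and for a real-valued $u\in W^{1,1}(\mathbb{R})$ let $$u^{*}(x)=\sup_{t>0}\,(|u|*\phi_t)(x),\qquad x\in\mathbb{R},$$ be the associated centered maximal function. Then, for every $u\in W^{1,1}(\mathbb{R})$, $u^{*}$ is finite everywhere and has a weak derivative $(u^{*})'\in L^1(\mathbb{R})$, and the map $u\mapsto (u^{*})'$ is continuous from $W^{1,1}(\mathbb{R})$, with the norm $\|u\|_{L^1}+\|u'\|_{L^1}$, to $L^1(\mathbb{R})$.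 -/

import Mathlib

open MeasureTheory
open scoped ContDiff Convolution

noncomputable section

/-- `g` is the weak derivative of `f` on the real line. -/
def IsWeakDeriv (f g : ℝ → ℝ) : Prop :=
  LocallyIntegrable f volume ∧ LocallyIntegrable g volume ∧
    ∀ ψ : ℝ → ℝ, ContDiff ℝ ∞ ψ → HasCompactSupport ψ →
      ∫ x, f x * deriv ψ x = -∫ x, g x * ψ x

theorem MeasureTheory.LocallyIntegrable.integrable_mul_test {f ψ : ℝ → ℝ}
    (hf : LocallyIntegrable f volume) (hψ : Continuous ψ) (hc : HasCompactSupport ψ) :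
    Integrable (fun x => f x * ψ x) volume := by
  simpa [mul_comm] using hf.integrable_smul_left_of_hasCompactSupport hψ hc

theorem IsWeakDeriv.congr {f f' g g' : ℝ → ℝ} (h : IsWeakDeriv f g)
    (hf : f =ᵐ[volume] f') (hg : g =ᵐ[volume] g') : IsWeakDeriv f' g' := by
  refine ⟨h.1.congr hf, h.2.1.congr hg, fun ψ hψ hc => ?_⟩
  have e1 : ∫ x, f' x * deriv ψ x = ∫ x, f x * deriv ψ x :=
    integral_congr_ae (by filter_upwards [hf] with x hx; rw [hx])
  have e2 : ∫ x, g' x * ψ x = ∫ x, g x * ψ x :=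
    integral_congr_ae (by filter_upwards [hg] with x hx; rw [hx])
  rw [e1, e2, h.2.2 ψ hψ hc]

theorem IsWeakDeriv.add {f f' g g' : ℝ → ℝ} (h : IsWeakDeriv f g) (h' : IsWeakDeriv f' g') :
    IsWeakDeriv (f + f') (g + g') := by
  refine ⟨h.1.add h'.1, h.2.1.add h'.2.1, fun ψ hψ hc => ?_⟩
  have hd : Continuous (deriv ψ) := hψ.continuous_deriv (by simp)
  simp only [Pi.add_apply, add_mul]
  rw [integral_add (h.1.integrable_mul_test hd hc.deriv) (h'.1.integrable_mul_test hd hc.deriv),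
    integral_add (h.2.1.integrable_mul_test hψ.continuous hc)
      (h'.2.1.integrable_mul_test hψ.continuous hc), h.2.2 ψ hψ hc, h'.2.2 ψ hψ hc]
  ring

theorem IsWeakDeriv.const_smul {f g : ℝ → ℝ} (c : ℝ) (h : IsWeakDeriv f g) :
    IsWeakDeriv (c • f) (c • g) := by
  refine ⟨h.1.smul c, h.2.1.smul c, fun ψ hψ hc => ?_⟩
  simp only [Pi.smul_apply, smul_eq_mul, mul_assoc, integral_const_mul, h.2.2 ψ hψ hc]
  ring

theorem isWeakDeriv_zero : IsWeakDeriv 0 0 :=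
  ⟨locallyIntegrable_zero, locallyIntegrable_zero, fun ψ _ _ => by simp⟩

/-- The Sobolev space `W^{1,1}(ℝ)`, each element being stored as the pair `(u, u')` of a function
in `L¹(ℝ)` and its weak derivative, also in `L¹(ℝ)`.  The norm inherited from
`WithLp 1 (L¹ × L¹)` is the Sobolev norm `‖u‖₁ + ‖u'‖₁`. -/
def SobolevW11 : Submodule ℝ (WithLp 1 ((ℝ →₁[volume] ℝ) × (ℝ →₁[volume] ℝ))) where
  carrier := {p | IsWeakDeriv p.fst p.snd}
  add_mem' {p q} hp hq :=
    (IsWeakDeriv.add hp hq).congr (Lp.coeFn_add p.fst q.fst).symm (Lp.coeFn_add p.snd q.snd).symm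
  zero_mem' := isWeakDeriv_zero.congr (Lp.coeFn_zero ..).symm (Lp.coeFn_zero ..).symm
  smul_mem' c p hp :=
    (IsWeakDeriv.const_smul c hp).congr (Lp.coeFn_smul c p.fst).symm (Lp.coeFn_smul c p.snd).symm

/-- The function `u` underlying an element of `W^{1,1}(ℝ)`. -/
def sobolevFun (u : SobolevW11) : ℝ → ℝ := u.1.fst

theorem SobolevW11.norm_eq (u : SobolevW11) : ‖u‖ = ‖u.1.fst‖ + ‖u.1.snd‖ :=
  WithLp.prod_norm_eq_of_L1 u.1

/-- The dilated kernel `φ_t(x) = t⁻¹ φ(x / t)`. -/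
def dilatedKernel (φ : ℝ → ℝ) (t x : ℝ) : ℝ := t⁻¹ * φ (x / t)

/-- The extension `ũ(x, t) = (|u| * φ_t)(x)`. -/
def kernelExtension (φ u : ℝ → ℝ) (x t : ℝ) : ℝ :=
  ((fun y => |u y|) ⋆ dilatedKernel φ t) x

/-- The centered maximal function `u*(x) = sup_{t > 0} (|u| * φ_t)(x)`. -/
def convMaximal (φ u : ℝ → ℝ) (x : ℝ) : ℝ :=
  sSup (kernelExtension φ u x '' Set.Ioi 0)

/-- The Poisson kernel `1 / (π (x² + 1))` of the line. -/
def lineKernelPoisson (x : ℝ) : ℝ := 1 / (Real.pi * (x ^ 2 + 1))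

/-- The heat kernel `(4π)^{-1/2} exp(-x²/4)` of the line. -/
def lineKernelHeat (x : ℝ) : ℝ := 1 / Real.sqrt (4 * Real.pi) * Real.exp (-x ^ 2 / 4)

/-- The fractional Poisson kernel `C (x² + 1)^{-(2-α)/2}` of the line, where `C` normalizes the
integral to one. -/
def lineKernelFractional (α x : ℝ) : ℝ :=
  (∫ y : ℝ, 1 / (y ^ 2 + 1) ^ ((2 - α) / 2))⁻¹ * (1 / (x ^ 2 + 1) ^ ((2 - α) / 2))

end

/-!
Write `f = |u|` for the absolutely continuous representative, `F = u*` for the maximal function and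
`h = F - f`, which is nonnegative since `φ_t` is an approximate identity.

**Convexity off the contact set.** On `{f < F}` the supremum over `t` is attained. If `F` were above
a chord of its graph there, then `F` minus a strictly concave parabola would have an interior
maximum; at that point and at a maximizing time the extension `|u| * φ_t` contradicts the equation
it solves, the heat equation or the degenerate elliptic equation of the fractional Poisson
extension. So `F` is locally convex on `{f < F}` (`MaxPrincipleKernel.convexlyDetached`); the
Poisson kernel is the fractional one with `α = 0`.

**Variation inequality.** If `g ≤ G` are absolutely continuous and `G` is locally convex on
`{g < G}`, then for every constant `p`
`∫_c^d |G' - p| ≤ ∫_c^d |g' - p| + (G - g)(c) + (G - g)(d)`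
(`ConvexlyDetached.integral_abs_deriv_sub_le`), because the sign of `G' - p` is monotone on each
component of `{g < G}`. With `p = 0`, and with `max f (F - ε)` in place of `F`, it shows that `F` is
absolutely continuous with integrable derivative (`ConvexlyDetached.locAC`).

**Continuity.** Let `F₁, f₁` belong to a function close to `u` in `W^{1,1}`. Then `F₁ - F` and
`f₁ - f` are uniformly at most some small `ρ`, so `g = max f₁ (F - ρ)` satisfies
`f₁ ≤ g ≤ F₁ ≤ g + 2ρ`, and `F₁` is locally convex on `{g < F₁}`. Since `F' = f'` almost everywhere
on the contact set, `g'` is close to `F'` in `L¹`. Approximating `F'` in `L¹` by a function that is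
nearly constant on the cells of a finite mesh and applying the variation inequality to `F₁, g` on
each cell, one gets `∫ |F₁' - F'| ≤ ∫ |g' - F'| + K ρ + δ`, with `K` depending only on `F'` and `δ`
(`ConvexlyDetached.exists_integral_abs_deriv_sub_le`).
-/

section

open Set Filter Topology

/-! ### Locally absolutely continuous functions -/

/-- A function on the line that is absolutely continuous on every compact interval. -/
def LocAC (f : ℝ → ℝ) : Prop := ∀ a b : ℝ, AbsolutelyContinuousOnInterval f a b

namespace LocAC

variable {f g : ℝ → ℝ}

theorem continuous (hf : LocAC f) : Continuous f := by
  rw [continuous_iff_continuousAt]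
  intro x
  refine ((hf (x - 1) (x + 1)).continuousOn).continuousAt ?_
  rw [uIcc_of_le (by linarith)]
  exact Icc_mem_nhds (by linarith) (by linarith)

theorem ae_differentiableAt (hf : LocAC f) : ∀ᵐ x, DifferentiableAt ℝ f x := by
  have h : ∀ n : ℕ, ∀ᵐ x, x ∈ uIcc (-(n : ℝ)) n → DifferentiableAt ℝ f x :=
    fun n => (hf _ _).ae_differentiableAt
  filter_upwards [ae_all_iff.2 h] with x hx
  obtain ⟨n, hn⟩ := exists_nat_ge |x|
  refine hx n ?_
  rw [uIcc_of_le (by linarith [abs_nonneg x])]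
  exact abs_le.1 hn

theorem intervalIntegrable_deriv (hf : LocAC f) (a b : ℝ) :
    IntervalIntegrable (deriv f) volume a b := (hf a b).intervalIntegrable_deriv

theorem integral_deriv (hf : LocAC f) (a b : ℝ) : ∫ x in a..b, deriv f x = f b - f a :=
  (hf a b).integral_deriv_eq_sub

theorem add (hf : LocAC f) (hg : LocAC g) : LocAC (fun x => f x + g x) :=
  fun a b => (hf a b).fun_add (hg a b)

theorem sub (hf : LocAC f) (hg : LocAC g) : LocAC (fun x => f x - g x) :=
  fun a b => (hf a b).fun_sub (hg a b)

end LocAC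

theorem ContDiff.locAC {f : ℝ → ℝ} (hf : ContDiff ℝ 1 f) : LocAC f :=
  fun _ _ => hf.contDiffOn.absolutelyContinuousOnInterval

theorem locAC_const (c : ℝ) : LocAC (fun _ => c) := contDiff_const.locAC

theorem AbsolutelyContinuousOnInterval.abs {f : ℝ → ℝ} {a b : ℝ}
    (hf : AbsolutelyContinuousOnInterval f a b) :
    AbsolutelyContinuousOnInterval (fun x => |f x|) a b := by
  refine squeeze_zero (fun t => Finset.sum_nonneg fun i _ => dist_nonneg) (fun t => ?_) hf
  refine Finset.sum_le_sum fun i _ => ?_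
  rw [Real.dist_eq, Real.dist_eq]
  exact abs_abs_sub_abs_le_abs_sub _ _

theorem AbsolutelyContinuousOnInterval.sup {f g : ℝ → ℝ} {a b : ℝ}
    (hf : AbsolutelyContinuousOnInterval f a b) (hg : AbsolutelyContinuousOnInterval g a b) :
    AbsolutelyContinuousOnInterval (fun x => max (f x) (g x)) a b := by
  have := ((hf.fun_add hg).fun_add (hf.fun_sub hg).abs).const_mul (1 / 2)
  refine this.congr' ?_
  refine Eventually.of_forall fun E => Finset.sum_congr rfl fun i _ => ?_
  have key : ∀ x y : ℝ, 1 / 2 * (x + y + |x - y|) = max x y := fun x y => by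
    rcases le_total x y with h | h
    · rw [max_eq_right h, abs_of_nonpos (by linarith)]; ring
    · rw [max_eq_left h, abs_of_nonneg (by linarith)]; ring
  simp only [key]

theorem LocAC.abs {f : ℝ → ℝ} (hf : LocAC f) : LocAC (fun x => |f x|) := fun a b => (hf a b).abs

theorem LocAC.sup {f g : ℝ → ℝ} (hf : LocAC f) (hg : LocAC g) :
    LocAC (fun x => max (f x) (g x)) := fun a b => (hf a b).sup (hg a b)

/-- Where `|f|` vanishes it has a minimum, so the derivative of `f` vanishes there too. -/
theorem LocAC.ae_deriv_eq_zero {f : ℝ → ℝ} (hf : LocAC f) : ∀ᵐ x, f x = 0 → deriv f x = 0 := by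
  filter_upwards [hf.abs.ae_differentiableAt] with x hx h0
  have hmin : IsLocalMin (fun x => |f x|) x :=
    Eventually.of_forall fun y => by simp [h0]
  have h1 : HasDerivAt (fun x => |f x|) 0 x := hmin.deriv_eq_zero ▸ hx.hasDerivAt
  refine HasDerivAt.deriv ?_
  rw [hasDerivAt_iff_isLittleO] at h1 ⊢
  simp only [h0, abs_zero, sub_zero, smul_zero] at h1 ⊢
  exact h1.of_abs_left

/-- Two locally absolutely continuous functions have the same derivative almost everywhere on the
set where they coincide. -/
theorem LocAC.ae_deriv_eq {f g : ℝ → ℝ} (hf : LocAC f) (hg : LocAC g) :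
    ∀ᵐ x, f x = g x → deriv f x = deriv g x := by
  filter_upwards [(hf.sub hg).ae_deriv_eq_zero, hf.ae_differentiableAt, hg.ae_differentiableAt]
    with x hx h1 h2 h
  have h3 := hx (by linarith)
  rw [deriv_fun_sub h1 h2] at h3
  linarith

theorem deriv_max_of_lt {f g : ℝ → ℝ} (hf : Continuous f) (hg : Continuous g) {x : ℝ}
    (h : g x < f x) : deriv (fun y => max (f y) (g y)) x = deriv f x := by
  refine EventuallyEq.deriv_eq ?_
  filter_upwards [(isOpen_lt hg hf).mem_nhds h] with y hy
  exact max_eq_left (le_of_lt hy)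

theorem MeasureTheory.LocallyIntegrable.intervalIntegrable_of_line {w : ℝ → ℝ}
    (hw : LocallyIntegrable w volume) (a b : ℝ) : IntervalIntegrable w volume a b :=
  intervalIntegrable_iff.2 ((hw.integrableOn_isCompact isCompact_uIcc).mono_set uIoc_subset_uIcc)

theorem locAC_integral {w : ℝ → ℝ} (hw : LocallyIntegrable w volume) (c a : ℝ) :
    LocAC (fun x => c + ∫ t in a..x, w t) := by
  intro x y
  have hi : ∀ p q, IntervalIntegrable w volume p q := fun p q =>
    hw.intervalIntegrable_of_line p q
  have h1 : AbsolutelyContinuousOnInterval (fun z => ∫ t in x..z, w t) x y :=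
    (hi x y).absolutelyContinuousOnInterval_intervalIntegral (by simp)
  have h2 := (locAC_const (c + ∫ t in a..x, w t) x y).fun_add h1
  have e : (fun z => c + ∫ t in a..z, w t) =
      fun z => (c + ∫ t in a..x, w t) + ∫ t in x..z, w t := by
    funext z
    rw [add_assoc, intervalIntegral.integral_add_adjacent_intervals (hi _ _) (hi _ _)]
  rw [e]; exact h2

theorem ae_deriv_integral {w : ℝ → ℝ} (hw : LocallyIntegrable w volume) (c a : ℝ) :
    ∀ᵐ x, deriv (fun x => c + ∫ t in a..x, w t) x = w x := by
  filter_upwards [_root_.LocallyIntegrable.ae_hasDerivAt_integral hw] with x hx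
  exact ((hx a).const_add c).deriv

theorem LocAC.locallyIntegrable_deriv {f : ℝ → ℝ} (hf : LocAC f) :
    LocallyIntegrable (deriv f) volume := by
  intro x
  have h := hf.intervalIntegrable_deriv (x - 1) (x + 1)
  rw [intervalIntegrable_iff_integrableOn_Icc_of_le (by linarith)] at h
  exact ⟨Icc (x - 1) (x + 1), Icc_mem_nhds (by linarith) (by linarith), h⟩

/-- Absolute continuity is a local property. -/
theorem locAC_of_local {f : ℝ → ℝ}
    (h : ∀ x, ∃ r > 0, AbsolutelyContinuousOnInterval f (x - r) (x + r)) : LocAC f := by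
  have hli : LocallyIntegrable (deriv f) volume := by
    intro x
    obtain ⟨r, hr, hx⟩ := h x
    have h := hx.intervalIntegrable_deriv
    rw [intervalIntegrable_iff_integrableOn_Icc_of_le (by linarith)] at h
    exact ⟨Icc (x - r) (x + r), Icc_mem_nhds (by linarith) (by linarith), h⟩
  have hlc : IsLocallyConstant (fun x => f x - ∫ t in (0 : ℝ)..x, deriv f t) := by
    rw [IsLocallyConstant.iff_eventually_eq]
    intro x
    obtain ⟨r, hr, hx⟩ := h x
    filter_upwards [Icc_mem_nhds (show x - r < x by linarith) (show x < x + r by linarith)]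
      with y hy
    have h1 : AbsolutelyContinuousOnInterval f x y := by
      refine hx.mono ?_
      rw [uIcc_of_le (show x - r ≤ x + r by linarith)]
      exact uIcc_subset_Icc ⟨by linarith, by linarith⟩ hy
    have h2 := h1.integral_deriv_eq_sub
    have h3 := intervalIntegral.integral_add_adjacent_intervals
      (hli.intervalIntegrable_of_line 0 x) (hli.intervalIntegrable_of_line x y)
    linarith
  have e : f = fun x => f 0 + ∫ t in (0 : ℝ)..x, deriv f t := by
    funext x
    have := hlc.apply_eq_of_preconnectedSpace x 0
    simp at this
    linarith
  rw [e]
  exact locAC_integral hli _ _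

/-- A function that is monotone near every point of the line is monotone. -/
theorem monotone_of_locally {f : ℝ → ℝ}
    (h : ∀ x, ∃ U ∈ 𝓝 x, MonotoneOn f U) : Monotone f := by
  intro a b hab
  choose U hU hm using h
  obtain ⟨t, h0, ht, ⟨n, hn⟩, hc⟩ := exists_monotone_Icc_subset_open_cover_Icc hab
    (c := fun x : ℝ => ((↑) : Icc a b → ℝ) ⁻¹' interior (U x))
    (fun x => isOpen_interior.preimage continuous_subtype_val)
    (fun y _ => mem_iUnion.2 ⟨y, mem_interior_iff_mem_nhds.2 (hU y)⟩)
  have step : ∀ k, f a ≤ f (t k) := by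
    intro k
    induction k with
    | zero => rw [h0]
    | succ k ih =>
      obtain ⟨i, hi⟩ := hc k
      have hk : t k ≤ t (k + 1) := ht (Nat.le_succ k)
      exact ih.trans (hm i (interior_subset (hi ⟨le_rfl, hk⟩))
        (interior_subset (hi ⟨hk, le_rfl⟩)) hk)
  have := step n
  rwa [hn n le_rfl] at this

/-! ### The variation inequality -/

/-- `F` is detached from `f` in a convex way: `f ≤ F`, and `F` is convex near every point at
which `f < F`. -/
structure ConvexlyDetached (F f : ℝ → ℝ) : Prop where
  le : ∀ x, f x ≤ F x
  convex : ∀ x, f x < F x → ∃ r > 0, ConvexOn ℝ (Ioo (x - r) (x + r)) F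

/-- The case of a sign function `s` of `∫ s q' ≤ [s q]`, valid for every monotone `s` and every
`q ≥ 0`. -/
theorem integral_sign_mul_deriv_le {s q : ℝ → ℝ} {x y : ℝ} (hxy : x ≤ y)
    (hs : MonotoneOn s (Icc x y)) (hs1 : ∀ z, s z = 1 ∨ s z = -1) (hq : LocAC q)
    (hq0 : ∀ z, 0 ≤ q z) :
    ∫ z in x..y, s z * deriv q z ≤ s y * q y - s x * q x := by
  have hconst : ∀ a b c : ℝ, x ≤ a → a ≤ b → b ≤ y → (∀ z ∈ Ioo a b, s z = c) →
      ∫ z in a..b, s z * deriv q z = c * (q b - q a) := by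
    intro a b c _ hab _ h
    rw [← hq.integral_deriv a b, ← intervalIntegral.integral_const_mul]
    rw [intervalIntegral.integral_of_le hab, intervalIntegral.integral_of_le hab,
      integral_Ioc_eq_integral_Ioo, integral_Ioc_eq_integral_Ioo]
    exact setIntegral_congr_fun measurableSet_Ioo fun z hz => by simp only [h z hz]
  have hxm : x ∈ Icc x y := ⟨le_rfl, hxy⟩
  have hym : y ∈ Icc x y := ⟨hxy, le_rfl⟩
  rcases hs1 x with hx | hx
  · have h1 : ∀ z ∈ Icc x y, s z = 1 := fun z hz => by
      rcases hs1 z with h | h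
      · exact h
      · have := hs hxm hz hz.1
        rw [hx, h] at this; norm_num at this
    rw [hconst x y 1 le_rfl hxy le_rfl fun z hz => h1 z (Ioo_subset_Icc_self hz), h1 y hym, hx]
    linarith
  rcases hs1 y with hy | hy
  swap
  · have h1 : ∀ z ∈ Icc x y, s z = -1 := fun z hz => by
      rcases hs1 z with h | h
      · have := hs hz hym hz.2
        rw [hy, h] at this; norm_num at this
      · exact h
    rw [hconst x y (-1) le_rfl hxy le_rfl fun z hz => h1 z (Ioo_subset_Icc_self hz), hy, hx]
    linarith
  set A := {z | z ∈ Icc x y ∧ s z = -1}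
  have hA : x ∈ A := ⟨hxm, hx⟩
  have hAb : BddAbove A := ⟨y, fun z hz => hz.1.2⟩
  set m := sSup A
  have hxm' : x ≤ m := le_csSup hAb hA
  have hmy : m ≤ y := csSup_le ⟨x, hA⟩ fun z hz => hz.1.2
  have e1 := hconst x m (-1) le_rfl hxm' hmy (by
    intro z hz
    obtain ⟨w, hw, hzw⟩ := exists_lt_of_lt_csSup ⟨x, hA⟩ hz.2
    rcases hs1 z with h | h
    · have := hs ⟨hz.1.le, hz.2.le.trans hmy⟩ hw.1 hzw.le
      rw [hw.2, h] at this; norm_num at this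
    · exact h)
  have e2 := hconst m y 1 hxm' hmy le_rfl (by
    intro z hz
    rcases hs1 z with h | h
    · exact h
    · exact absurd (le_csSup hAb ⟨⟨hxm'.trans hz.1.le, hz.2.le⟩, h⟩) (not_le.2 hz.1))
  have hii : IntervalIntegrable (fun z => s z * deriv q z) volume x y := by
    rw [intervalIntegrable_iff_integrableOn_Icc_of_le hxy]
    have hd := (intervalIntegrable_iff_integrableOn_Icc_of_le hxy).1
      (hq.intervalIntegrable_deriv x y)
    refine Integrable.mono' hd.norm
      ((aemeasurable_restrict_of_monotoneOn measurableSet_Icc hs).aestronglyMeasurable.mul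
        hd.aestronglyMeasurable) (Eventually.of_forall fun z => ?_)
    rcases hs1 z with h | h <;> simp [h]
  have hm : m ∈ uIcc x y := by rw [uIcc_of_le hxy]; exact ⟨hxm', hmy⟩
  rw [← intervalIntegral.integral_add_adjacent_intervals (b := m)
    (hii.mono_set (uIcc_subset_uIcc_left hm)) (hii.mono_set (uIcc_subset_uIcc_right hm)),
    e1, e2, hx, hy]
  linarith [hq0 m]

/-- The sign of `G' - p`, with the right derivative, and with the value `1` at `0`. -/
noncomputable def slopeSign (G : ℝ → ℝ) (p x : ℝ) : ℝ :=
  if p ≤ derivWithin G (Ioi x) x then 1 else -1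

theorem slopeSign_eq (G : ℝ → ℝ) (p x : ℝ) : slopeSign G p x = 1 ∨ slopeSign G p x = -1 := by
  unfold slopeSign; split_ifs <;> simp

theorem abs_slopeSign (G : ℝ → ℝ) (p x : ℝ) : |slopeSign G p x| = 1 := by
  rcases slopeSign_eq G p x with h | h <;> simp [h]

theorem measurable_slopeSign (G : ℝ → ℝ) (p : ℝ) : Measurable (slopeSign G p) :=
  Measurable.ite (measurableSet_le measurable_const (measurable_derivWithin_Ioi G))
    measurable_const measurable_const

theorem ConvexOn.monotoneOn_slopeSign {G : ℝ → ℝ} {a b : ℝ} (h : ConvexOn ℝ (Ioo a b) G)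
    (p : ℝ) : MonotoneOn (slopeSign G p) (Ioo a b) := by
  intro x hx y hy hxy
  have := h.monotoneOn_rightDeriv (by rwa [interior_Ioo]) (by rwa [interior_Ioo]) hxy
  unfold slopeSign
  split_ifs with h1 h2 h2
  · exact le_rfl
  · exact absurd (h1.trans this) h2
  · norm_num
  · exact le_rfl

theorem slopeSign_mul {G : ℝ → ℝ} {p x : ℝ} (h : DifferentiableAt ℝ G x) :
    slopeSign G p x * (deriv G x - p) = |deriv G x - p| := by
  unfold slopeSign
  rw [h.derivWithin (uniqueDiffWithinAt_Ioi x)]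
  split_ifs with h1
  · rw [abs_of_nonneg (by linarith)]; ring
  · rw [abs_of_nonpos (by linarith)]; ring

theorem slopeSign_mul_le (G : ℝ → ℝ) (p x y : ℝ) : slopeSign G p x * y ≤ |y| := by
  rcases slopeSign_eq G p x with h | h
  · rw [h, one_mul]; exact le_abs_self y
  · rw [h, neg_one_mul]; exact neg_le_abs y

theorem LocAC.locallyIntegrable_slopeSign_mul {q : ℝ → ℝ} (hq : LocAC q) (G : ℝ → ℝ) (p : ℝ) :
    LocallyIntegrable (fun z => slopeSign G p z * deriv q z) volume := by
  refine hq.locallyIntegrable_deriv.mono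
    ((measurable_slopeSign G p).mul (measurable_deriv q)).aestronglyMeasurable
    (Eventually.of_forall fun z => ?_)
  rw [Real.norm_eq_abs, abs_mul, abs_slopeSign, one_mul, Real.norm_eq_abs]

/-- Truncating `G - g` at height `ε` keeps its support away from the contact set, so that the
monotonicity of the sign of `G' - p` can be used near every point of the line. -/
theorem ConvexlyDetached.integral_slopeSign_truncated {G g : ℝ → ℝ} (h : ConvexlyDetached G g)
    (hG : LocAC G) (hg : LocAC g) (p : ℝ) {ε : ℝ} (hε : 0 < ε) {c d : ℝ} (hcd : c ≤ d) :
    ∫ z in c..d, slopeSign G p z * deriv (fun x => max (G x - g x - ε) 0) z ≤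
      (G c - g c) + (G d - g d) := by
  set q := fun x => max (G x - g x - ε) 0
  have hq : LocAC q := ((hG.sub hg).sub (locAC_const ε)).sup (locAC_const 0)
  have hq0 : ∀ x, 0 ≤ q x := fun x => le_max_right _ _
  have hqh : ∀ x, q x ≤ G x - g x := fun x => max_le (by linarith) (by linarith [h.le x])
  have hli := hq.locallyIntegrable_slopeSign_mul G p
  have hmono : Monotone fun x =>
      slopeSign G p x * q x - ∫ z in c..x, slopeSign G p z * deriv q z := by
    refine monotone_of_locally fun x => ?_
    rcases (h.le x).eq_or_lt with hx | hx
    · have hev : ∀ᶠ y in 𝓝 x, q y = 0 := by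
        have : ∀ᶠ y in 𝓝 x, G y - g y < ε :=
          (hG.sub hg).continuous.continuousAt.eventually_lt continuousAt_const
            (by simpa [hx] using hε)
        filter_upwards [this] with y hy
        exact max_eq_right (by linarith)
      obtain ⟨r, hr, hb⟩ := Metric.eventually_nhds_iff_ball.1 hev
      refine ⟨Metric.ball x r, Metric.ball_mem_nhds x hr, fun y hy z hz hyz => ?_⟩
      have h0 : ∫ t in y..z, slopeSign G p t * deriv q t = 0 := by
        refine intervalIntegral.integral_zero_ae (Eventually.of_forall fun t ht => ?_)
        rw [uIoc_of_le hyz] at ht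
        rw [Real.ball_eq_Ioo] at hy hz hb
        have : q =ᶠ[𝓝 t] fun _ => 0 := by
          filter_upwards [Ioo_mem_nhds (hy.1.trans ht.1) (ht.2.trans_lt hz.2)] with w hw
          exact hb w hw
        rw [this.deriv_eq]; simp
      have := intervalIntegral.integral_add_adjacent_intervals
        (hli.intervalIntegrable_of_line c y) (hli.intervalIntegrable_of_line y z)
      simp only [hb y hy, hb z hz]
      linarith
    · obtain ⟨r, hr, hc⟩ := h.convex x hx
      refine ⟨Ioo (x - r) (x + r), Ioo_mem_nhds (by linarith) (by linarith),
        fun y hy z hz hyz => ?_⟩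
      have h1 := integral_sign_mul_deriv_le hyz ((hc.monotoneOn_slopeSign p).mono
        (Icc_subset_Ioo hy.1 hz.2)) (slopeSign_eq G p) hq hq0
      have := intervalIntegral.integral_add_adjacent_intervals
        (hli.intervalIntegrable_of_line c y) (hli.intervalIntegrable_of_line y z)
      simp only
      linarith
  have h1 := hmono hcd
  simp only [intervalIntegral.integral_same] at h1
  have h2 := slopeSign_mul_le G p d (q d)
  have h3 : -(slopeSign G p c * q c) ≤ |q c| := by
    rcases slopeSign_eq G p c with h | h <;> rw [h]
    · rw [one_mul]; exact neg_le_abs _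
    · rw [neg_one_mul, neg_neg]; exact le_abs_self _
  rw [abs_of_nonneg (hq0 _)] at h2 h3
  linarith [hqh c, hqh d]

theorem deriv_max_sub_const (h : ℝ → ℝ) (hc : Continuous h) {ε x : ℝ} :
    (ε < h x → deriv (fun x => max (h x - ε) 0) x = deriv h x) ∧
    (h x < ε → deriv (fun x => max (h x - ε) 0) x = 0) := by
  constructor
  · intro hx
    rw [deriv_max_of_lt (f := fun x => h x - ε) (g := fun _ => 0) (by fun_prop) (by fun_prop)
      (by simpa using hx)]
    simp
  · intro hx
    have : (fun x => max (h x - ε) 0) =ᶠ[𝓝 x] fun _ => 0 := by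
      filter_upwards [hc.continuousAt.eventually_lt continuousAt_const hx] with y hy
      exact max_eq_right (by linarith)
    rw [this.deriv_eq]; simp

theorem LocAC.ae_tendsto_deriv_truncated {h : ℝ → ℝ} (hh : LocAC h) (h0 : ∀ x, 0 ≤ h x) :
    ∀ᵐ x, Tendsto (fun n : ℕ => deriv (fun x => max (h x - 1 / ((n : ℝ) + 1)) 0) x) atTop
      (𝓝 (deriv h x)) := by
  filter_upwards [hh.ae_deriv_eq_zero] with x hx
  refine tendsto_const_nhds.congr' ?_
  rcases (h0 x).eq_or_lt with hz | hz
  · rw [hx hz.symm]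
    refine Eventually.of_forall fun n => ?_
    refine ((deriv_max_sub_const h hh.continuous).2 ?_).symm
    rw [← hz]; positivity
  · filter_upwards [(tendsto_one_div_add_atTop_nhds_zero_nat (𝕜 := ℝ)).eventually_lt_const hz]
      with n hn
    exact ((deriv_max_sub_const h hh.continuous).1 hn).symm

theorem LocAC.ae_abs_deriv_truncated_le {h : ℝ → ℝ} (hh : LocAC h) (ε : ℝ) :
    ∀ᵐ x, |deriv (fun x => max (h x - ε) 0) x| ≤ |deriv h x| := by
  filter_upwards [((hh.sub (locAC_const ε)).sup (locAC_const 0)).ae_deriv_eq (locAC_const 0)]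
    with x hx
  rcases lt_or_ge ε (h x) with h1 | h1
  · rw [(deriv_max_sub_const h hh.continuous).1 h1]
  · rw [hx (max_eq_right (by linarith))]; simp

/-- The variation inequality.  Convexity makes the sign `s` of `G' - p` monotone off the contact
set, hence `∫ s (G - g)' ≤ [s (G - g)]`: up to boundary terms, `G - p x` has the smaller
variation. -/
theorem ConvexlyDetached.integral_abs_deriv_sub_le {G g : ℝ → ℝ} (h : ConvexlyDetached G g)
    (hG : LocAC G) (hg : LocAC g) (p : ℝ) {c d : ℝ} (hcd : c ≤ d) :
    ∫ z in c..d, |deriv G z - p| ≤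
      (∫ z in c..d, |deriv g z - p|) + ((G c - g c) + (G d - g d)) := by
  have hh := hG.sub hg
  have hint : ∀ k : ℝ → ℝ, LocAC k → IntervalIntegrable (fun z => |deriv k z - p|) volume c d :=
    fun k hk => ((hk.intervalIntegrable_deriv c d).sub intervalIntegrable_const).abs
  have hS : ∫ z in c..d, slopeSign G p z * deriv (fun x => G x - g x) z ≤
      (G c - g c) + (G d - g d) := by
    have ht : Tendsto (fun n : ℕ => ∫ z in c..d, slopeSign G p z *
        deriv (fun x => max (G x - g x - 1 / ((n : ℝ) + 1)) 0) z) atTop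
        (𝓝 (∫ z in c..d, slopeSign G p z * deriv (fun x => G x - g x) z)) := by
      refine intervalIntegral.tendsto_integral_filter_of_dominated_convergence
        (fun z => |deriv (fun x => G x - g x) z|) ?_ ?_ (hh.intervalIntegrable_deriv c d).abs ?_
      · exact Eventually.of_forall fun n =>
          ((measurable_slopeSign G p).mul (measurable_deriv _)).aestronglyMeasurable
      · refine Eventually.of_forall fun n => ?_
        filter_upwards [hh.ae_abs_deriv_truncated_le (1 / ((n : ℝ) + 1))] with z hz _
        rw [Real.norm_eq_abs, abs_mul, abs_slopeSign, one_mul]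
        exact hz
      · filter_upwards [hh.ae_tendsto_deriv_truncated fun x => by linarith [h.le x]] with z hz _
        exact hz.const_mul _
    exact le_of_tendsto' ht fun n =>
      h.integral_slopeSign_truncated hG hg p (by positivity) hcd
  have hSi := (hh.locallyIntegrable_slopeSign_mul G p).intervalIntegrable_of_line c d
  calc ∫ z in c..d, |deriv G z - p|
      ≤ ∫ z in c..d, (|deriv g z - p| + slopeSign G p z * deriv (fun x => G x - g x) z) := by
        refine intervalIntegral.integral_mono_ae hcd (hint G hG) ((hint g hg).add hSi) ?_
        filter_upwards [hG.ae_differentiableAt, hg.ae_differentiableAt] with z h1 h2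
        rw [deriv_fun_sub h1 h2, ← slopeSign_mul h1]
        have := slopeSign_mul_le G p z (deriv g z - p)
        linarith
    _ ≤ _ := by
        rw [intervalIntegral.integral_add (hint g hg) hSi]
        linarith

/-! ### Absolute continuity of convexly detached functions -/

theorem AbsolutelyContinuousOnInterval.congr {f g : ℝ → ℝ} {a b : ℝ}
    (hf : AbsolutelyContinuousOnInterval f a b) (h : EqOn f g (uIcc a b)) :
    AbsolutelyContinuousOnInterval g a b := by
  refine Tendsto.congr' ?_ hf
  have : ∀ᶠ E in AbsolutelyContinuousOnInterval.totalLengthFilter ⊓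
      𝓟 (AbsolutelyContinuousOnInterval.disjWithin a b),
      E ∈ AbsolutelyContinuousOnInterval.disjWithin a b :=
    mem_inf_of_right (mem_principal_self _)
  filter_upwards [this] with E hE
  refine Finset.sum_congr rfl fun i hi => ?_
  rw [h (hE.1 i hi).1, h (hE.1 i hi).2]

theorem ConvexOn.exists_absolutelyContinuousOnInterval {F : ℝ → ℝ} {x r : ℝ} (hr : 0 < r)
    (h : ConvexOn ℝ (Ioo (x - r) (x + r)) F) :
    ∃ ρ > 0, AbsolutelyContinuousOnInterval F (x - ρ) (x + ρ) := by
  obtain ⟨K, t, ht, hK⟩ := h.locallyLipschitzOn isOpen_Ioo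
    (show x ∈ Ioo (x - r) (x + r) from ⟨by linarith, by linarith⟩)
  rw [isOpen_Ioo.nhdsWithin_eq ⟨by linarith, by linarith⟩] at ht
  obtain ⟨ρ, hρ, hsub⟩ := Metric.nhds_basis_closedBall.mem_iff.1 ht
  rw [Real.closedBall_eq_Icc] at hsub
  refine ⟨ρ, hρ, LipschitzOnWith.absolutelyContinuousOnInterval (K := K) (hK.mono ?_)⟩
  rwa [uIcc_of_le (by linarith)]

/-- Lowering a convexly detached function keeps it convexly detached. -/
theorem ConvexlyDetached.max_sub_const {F f : ℝ → ℝ} (h : ConvexlyDetached F f)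
    (hF : Continuous F) (hf : Continuous f) {ε : ℝ} (hε : 0 ≤ ε) :
    ConvexlyDetached (fun x => max (f x) (F x - ε)) f := by
  refine ⟨fun x => le_max_left _ _, fun x hx => ?_⟩
  have hx' : f x < F x - ε := by
    rcases lt_max_iff.1 hx with h | h
    · exact absurd h (lt_irrefl _)
    · exact h
  obtain ⟨r, hr, hc⟩ := h.convex x (by linarith)
  obtain ⟨ρ, hρ, hsub⟩ := Metric.mem_nhds_iff.1
    ((isOpen_lt hf (hF.sub continuous_const)).mem_nhds hx')
  rw [Real.ball_eq_Ioo] at hsub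
  refine ⟨min r ρ, lt_min hr hρ, ?_⟩
  have h1 : ConvexOn ℝ (Ioo (x - min r ρ) (x + min r ρ)) F :=
    hc.subset (Ioo_subset_Ioo (by linarith [min_le_left r ρ]) (by linarith [min_le_left r ρ]))
      (convex_Ioo _ _)
  refine (h1.add_const (-ε)).congr fun y hy => ?_
  have h2 : f y < F y - ε :=
    hsub ⟨by linarith [min_le_right r ρ, hy.1], by linarith [min_le_right r ρ, hy.2]⟩
  simp only [Pi.add_apply]
  rw [max_eq_right h2.le]; ring

theorem ConvexlyDetached.locAC_max_sub_const {F f : ℝ → ℝ} (h : ConvexlyDetached F f)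
    (hF : Continuous F) (hf : LocAC f) {ε : ℝ} (hε : 0 < ε) :
    LocAC (fun x => max (f x) (F x - ε)) := by
  refine locAC_of_local fun x => ?_
  rcases (h.le x).eq_or_lt with hx | hx
  · have hx' : F x - ε < f x := by linarith
    obtain ⟨ρ, hρ, hsub⟩ := Metric.nhds_basis_closedBall.mem_iff.1
      ((isOpen_lt (hF.sub continuous_const) hf.continuous).mem_nhds hx')
    rw [Real.closedBall_eq_Icc] at hsub
    refine ⟨ρ, hρ, (hf _ _).congr fun y hy => ?_⟩
    rw [uIcc_of_le (by linarith)] at hy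
    have : F y - ε < f y := hsub hy
    exact (max_eq_left this.le).symm
  · obtain ⟨r, hr, hc⟩ := h.convex x hx
    obtain ⟨ρ, hρ, hac⟩ := hc.exists_absolutelyContinuousOnInterval hr
    exact ⟨ρ, hρ, (hf _ _).sup (hac.fun_sub (locAC_const ε _ _))⟩

theorem deriv_max_sub_const_eq {F f : ℝ → ℝ} (hF : Continuous F) (hf : Continuous f) {ε x : ℝ} :
    (f x < F x - ε → deriv (fun x => max (f x) (F x - ε)) x = deriv F x) ∧
    (F x - ε < f x → deriv (fun x => max (f x) (F x - ε)) x = deriv f x) := by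
  constructor
  · intro hx
    have e : (fun x => max (f x) (F x - ε)) = fun x => max (F x - ε) (f x) := by
      funext x; exact max_comm _ _
    rw [e, deriv_max_of_lt (f := fun x => F x - ε) (by fun_prop) hf hx]
    simp
  · intro hx
    exact deriv_max_of_lt hf (by fun_prop) hx

theorem LocAC.integrable_deriv_of_bound {m : ℝ → ℝ} (hm : LocAC m) {C : ℝ}
    (h : ∀ R : ℝ, 0 ≤ R → ∫ z in -R..R, |deriv m z| ≤ C) :
    Integrable (deriv m) ∧ ∫ z, |deriv m z| ≤ C := by
  have ha : Tendsto (fun n : ℕ => -(n : ℝ)) atTop atBot :=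
    tendsto_neg_atTop_atBot.comp tendsto_natCast_atTop_atTop
  have hb : Tendsto (fun n : ℕ => (n : ℝ)) atTop atTop := tendsto_natCast_atTop_atTop
  have hi : Integrable (deriv m) := by
    refine integrable_of_intervalIntegral_norm_bounded (a := fun n : ℕ => -(n : ℝ))
      (b := fun n : ℕ => (n : ℝ)) (l := atTop) C (fun n => ?_) ha hb ?_
    · exact (intervalIntegrable_iff_integrableOn_Ioc_of_le
        (by linarith [n.cast_nonneg (α := ℝ)])).1 (hm.intervalIntegrable_deriv _ _)
    · exact Eventually.of_forall fun n => h n n.cast_nonneg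
  exact ⟨hi, le_of_tendsto' (intervalIntegral_tendsto_integral hi.abs ha hb)
    fun n => h n n.cast_nonneg⟩

/-- A consequence of Fatou's lemma. -/
theorem integrable_of_tendsto_of_integral_abs_le {k : ℕ → ℝ → ℝ} {w : ℝ → ℝ} {C : ℝ}
    (hk : ∀ n, Integrable (k n)) (hw : AEStronglyMeasurable w volume)
    (hC : ∀ n, ∫ z, |k n z| ≤ C)
    (ht : ∀ᵐ x, Tendsto (fun n => k n x) atTop (𝓝 (w x))) : Integrable w := by
  refine ⟨hw, ?_⟩
  have h1 : ∫⁻ x, ‖w x‖ₑ ≤ liminf (fun n => ∫⁻ x, ‖k n x‖ₑ) atTop := by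
    calc ∫⁻ x, ‖w x‖ₑ = ∫⁻ x, liminf (fun n => ‖k n x‖ₑ) atTop := by
          refine lintegral_congr_ae ?_
          filter_upwards [ht] with x hx
          exact hx.enorm.liminf_eq.symm
      _ ≤ _ := lintegral_liminf_le' fun n => (hk n).aestronglyMeasurable.enorm
  refine lt_of_le_of_lt (h1.trans ?_) (ENNReal.ofReal_lt_top (r := C))
  refine liminf_le_of_le ⟨0, by simp⟩ fun b hb => ?_
  obtain ⟨n, hn⟩ := hb.exists
  refine hn.trans ?_
  rw [← ofReal_integral_norm_eq_lintegral_enorm (hk n)]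
  exact ENNReal.ofReal_le_ofReal (hC n)

/-- A continuous function convexly detached from an absolutely continuous one is absolutely
continuous: the truncations `max f (F - ε)` are, their variations are bounded uniformly in `ε`,
and `ε → 0`. -/
theorem ConvexlyDetached.locAC {F f : ℝ → ℝ} (h : ConvexlyDetached F f)
    (hF : Continuous F) (hf : LocAC f) (hfi : Integrable (deriv f)) {B : ℝ}
    (hB : ∀ x, F x - f x ≤ B) : LocAC F ∧ Integrable (deriv F) := by
  set ε : ℕ → ℝ := fun n => 1 / ((n : ℝ) + 1) with hεdef
  have hε : ∀ n, 0 < ε n := fun n => by positivity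
  have hε0 : Tendsto ε atTop (𝓝 0) := tendsto_one_div_add_atTop_nhds_zero_nat
  set m : ℕ → ℝ → ℝ := fun n x => max (f x) (F x - ε n) with hmdef
  have hm : ∀ n, LocAC (m n) := fun n => h.locAC_max_sub_const hF hf (hε n)
  have hB0 : 0 ≤ B := by linarith [hB 0, h.le 0]
  have hmB : ∀ n x, m n x - f x ≤ B := fun n x => by
    have : m n x ≤ f x + B := max_le (by linarith) (by linarith [hB x, hε n])
    linarith
  have hmi : ∀ n, Integrable (deriv (m n)) ∧
      ∫ z, |deriv (m n) z| ≤ (∫ z, |deriv f z|) + 2 * B := by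
    intro n
    refine (hm n).integrable_deriv_of_bound fun R hR => ?_
    have h1 := (h.max_sub_const hF hf.continuous (hε n).le).integral_abs_deriv_sub_le
      (hm n) hf 0 (show -R ≤ R by linarith)
    simp only [sub_zero] at h1
    have h2 : ∫ z in -R..R, |deriv f z| ≤ ∫ z, |deriv f z| := by
      rw [intervalIntegral.integral_of_le (by linarith)]
      exact setIntegral_le_integral hfi.abs (Eventually.of_forall fun z => abs_nonneg _)
    linarith [hmB n (-R), hmB n R]
  -- the candidate for `F'`: the derivative of `F` off the contact set, that of `f` on it
  set w : ℝ → ℝ := fun x => if f x < F x then deriv F x else deriv f x with hw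
  have hwm : Measurable w := Measurable.ite (isOpen_lt hf.continuous hF).measurableSet
    (measurable_deriv F) (measurable_deriv f)
  have ht : ∀ x, Tendsto (fun n => deriv (m n) x) atTop (𝓝 (w x)) := by
    intro x
    refine tendsto_const_nhds.congr' ?_
    rcases (h.le x).eq_or_lt with hx | hx
    · refine Eventually.of_forall fun n => ?_
      have := (deriv_max_sub_const_eq hF hf.continuous (ε := ε n) (x := x)).2
        (by linarith [hε n])
      simp only [hw, hx, lt_irrefl, if_false]
      exact this.symm
    · filter_upwards [hε0.eventually_lt_const (show 0 < F x - f x by linarith)] with n hn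
      have := (deriv_max_sub_const_eq hF hf.continuous (ε := ε n) (x := x)).1 (by linarith)
      simp only [hw, hx, if_true]
      exact this.symm
  have hwi : Integrable w := integrable_of_tendsto_of_integral_abs_le (fun n => (hmi n).1)
    hwm.aestronglyMeasurable (fun n => (hmi n).2) (Eventually.of_forall ht)
  have hdom : ∀ n, ∀ᵐ x, |deriv (m n) x| ≤ |w x| + |deriv f x| := by
    intro n
    filter_upwards [(hm n).ae_deriv_eq hf] with x hx
    rcases lt_or_ge (f x) (F x - ε n) with h1 | h1
    · rw [(deriv_max_sub_const_eq hF hf.continuous).1 h1]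
      have : f x < F x := by linarith [hε n]
      simp only [hw, this, if_true]
      linarith [abs_nonneg (deriv f x)]
    · rw [hx (max_eq_left h1)]
      linarith [abs_nonneg (w x)]
  have hFw : F = fun x => F 0 + ∫ t in (0 : ℝ)..x, w t := by
    funext x
    have hlim : ∀ y, Tendsto (fun n => m n y) atTop (𝓝 (F y)) := fun y => by
      have : Tendsto (fun n => max (f y) (F y - ε n)) atTop (𝓝 (max (f y) (F y - 0))) :=
        tendsto_const_nhds.max (tendsto_const_nhds.sub hε0)
      rwa [sub_zero, max_eq_right (h.le y)] at this
    have h1 : Tendsto (fun n => ∫ t in (0 : ℝ)..x, deriv (m n) t) atTop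
        (𝓝 (∫ t in (0 : ℝ)..x, w t)) := by
      refine intervalIntegral.tendsto_integral_filter_of_dominated_convergence
        (fun z => |w z| + |deriv f z|)
        (Eventually.of_forall fun n => (measurable_deriv _).aestronglyMeasurable)
        (Eventually.of_forall fun n => ?_) (hwi.abs.add hfi.abs).intervalIntegrable
        (Eventually.of_forall fun z _ => ht z)
      filter_upwards [hdom n] with z hz _
      exact hz
    have h2 : Tendsto (fun n => ∫ t in (0 : ℝ)..x, deriv (m n) t) atTop (𝓝 (F x - F 0)) := by
      simp only [fun n => (hm n).integral_deriv 0 x]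
      exact (hlim x).sub (hlim 0)
    linarith [tendsto_nhds_unique h1 h2]
  have hli := hwi.locallyIntegrable
  refine ⟨by rw [hFw]; exact locAC_integral hli _ _, hwi.congr ?_⟩
  filter_upwards [ae_deriv_integral hli (F 0) 0] with x hx
  rw [hFw]; exact hx.symm

/-! ### Stability of the derivative of convexly detached functions -/

/-- If `k = 0` almost everywhere on `{h = 0}`, then `k` is small in `L¹` on a thin sublevel set of
`h`. -/
theorem exists_setIntegral_abs_le_of_ae_zero {h k : ℝ → ℝ} (hh : Continuous h)
    (h0 : ∀ x, 0 ≤ h x) (hk : Integrable k) (hz : ∀ᵐ x, h x = 0 → k x = 0) {δ : ℝ}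
    (hδ : 0 < δ) : ∃ ρ > 0, ∫ x, {x | h x ≤ ρ}.indicator (fun x => |k x|) x ≤ δ := by
  have hε0 : Tendsto (fun n : ℕ => 1 / ((n : ℝ) + 1)) atTop (𝓝 0) :=
    tendsto_one_div_add_atTop_nhds_zero_nat
  have ht : Tendsto (fun n : ℕ =>
      ∫ x, {x | h x ≤ 1 / ((n : ℝ) + 1)}.indicator (fun x => |k x|) x) atTop
      (𝓝 (∫ _ : ℝ, (0 : ℝ))) := by
    refine tendsto_integral_of_dominated_convergence (fun x => |k x|) (fun n => ?_) hk.abs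
      (fun n => Eventually.of_forall fun x => ?_) ?_
    · exact hk.abs.aestronglyMeasurable.indicator
        (isClosed_le hh continuous_const).measurableSet
    · rw [Real.norm_eq_abs, abs_of_nonneg (indicator_nonneg (fun _ _ => abs_nonneg _) _)]
      exact indicator_le_self' (fun _ _ => abs_nonneg _) _
    · filter_upwards [hz] with x hx
      refine tendsto_const_nhds.congr' ?_
      rcases (h0 x).eq_or_lt with h1 | h1
      · refine Eventually.of_forall fun n => ?_
        simp [indicator, hx h1.symm]
      · filter_upwards [hε0.eventually_lt_const h1] with n hn
        exact (indicator_of_notMem (by simpa using hn) _).symm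
  rw [integral_zero] at ht
  obtain ⟨n, hn⟩ := (ht.eventually_lt_const hδ).exists
  exact ⟨_, by positivity, hn.le⟩

/-- The variation inequality with the constant `p` replaced by a compactly supported continuous
function, which is nearly constant on the cells of a fine mesh. -/
theorem exists_integral_abs_deriv_sub_le_of_hasCompactSupport {p : ℝ → ℝ} (hp : Continuous p)
    (hc : HasCompactSupport p) {δ : ℝ} (hδ : 0 < δ) :
    ∃ K : ℝ, 0 ≤ K ∧ ∀ (G g : ℝ → ℝ) (η : ℝ), ConvexlyDetached G g → LocAC G → LocAC g →
      Integrable (deriv G) → Integrable (deriv g) → (∀ x, G x - g x ≤ η) →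
      ∫ x, |deriv G x - p x| ≤ (∫ x, |deriv g x - p x|) + K * η + δ := by
  obtain ⟨R, hR, hsupp⟩ : ∃ R : ℝ, 0 < R ∧ ∀ x, R ≤ |x| → p x = 0 := by
    obtain ⟨R, hR, hs⟩ := hc.exists_pos_le_norm
    exact ⟨R, hR, hs⟩
  have hpi : Integrable p := hp.integrable_of_hasCompactSupport hc
  have huc := hc.uniformContinuous_of_continuous hp
  set κ := δ / (2 * (2 * R + 1)) with hκ
  have hκ0 : 0 < κ := by positivity
  obtain ⟨τ₀, hτ₀, hτ⟩ := Metric.uniformContinuous_iff.1 huc κ hκ0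
  set τ := min (τ₀ / 2) 1
  have hτ0 : 0 < τ := lt_min (by linarith) one_pos
  set N := ⌈2 * R / τ⌉₊
  have hN1 : 2 * R ≤ N * τ := by
    have := Nat.le_ceil (2 * R / τ)
    rwa [div_le_iff₀ hτ0] at this
  have hN2 : N * τ ≤ 2 * R + 1 := by
    have := Nat.ceil_lt_add_one (show 0 ≤ 2 * R / τ by positivity)
    have h2 : (N : ℝ) * τ ≤ (2 * R / τ + 1) * τ := by gcongr
    have h3 : (2 * R / τ + 1) * τ = 2 * R + τ := by field_simp
    linarith [min_le_right (τ₀ / 2) 1]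
  refine ⟨2 * N + 4, by positivity, fun G g η hGg hG hg hGi hgi hη => ?_⟩
  have iG : ∀ a b, IntervalIntegrable (fun x => |deriv G x - p x|) volume a b := fun a b =>
    (hGi.sub hpi).abs.intervalIntegrable
  have ig : ∀ a b, IntervalIntegrable (fun x => |deriv g x - p x|) volume a b := fun a b =>
    (hgi.sub hpi).abs.intervalIntegrable
  have hηb : ∀ a b, (G a - g a) + (G b - g b) ≤ 2 * η := fun a b => by linarith [hη a, hη b]
  -- one cell of the mesh
  have cell : ∀ a : ℝ, ∫ x in a..a + τ, |deriv G x - p x| ≤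
      (∫ x in a..a + τ, |deriv g x - p x|) + 2 * η + 2 * κ * τ := by
    intro a
    have hle : a ≤ a + τ := by linarith
    have hclose : ∀ x ∈ Icc a (a + τ), |p x - p a| ≤ κ := fun x hx => by
      refine (hτ (a := x) (b := a) ?_).le
      rw [Real.dist_eq, abs_of_nonneg (by linarith [hx.1])]
      linarith [hx.2, min_le_left (τ₀ / 2) 1]
    have iGa : IntervalIntegrable (fun x => |deriv G x - p a|) volume a (a + τ) :=
      (hGi.intervalIntegrable.sub intervalIntegrable_const).abs
    have iga : IntervalIntegrable (fun x => |deriv g x - p a|) volume a (a + τ) :=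
      (hgi.intervalIntegrable.sub intervalIntegrable_const).abs
    have h1 : ∫ x in a..a + τ, |deriv G x - p x| ≤
        ∫ x in a..a + τ, (|deriv G x - p a| + κ) := by
      refine intervalIntegral.integral_mono_on hle (iG _ _)
        (iGa.add intervalIntegrable_const) fun x hx => ?_
      have := abs_sub_le (deriv G x) (p a) (p x)
      rw [abs_sub_comm (p a)] at this
      linarith [hclose x hx]
    have h2 : ∫ x in a..a + τ, |deriv g x - p a| ≤
        ∫ x in a..a + τ, (|deriv g x - p x| + κ) := by
      refine intervalIntegral.integral_mono_on hle iga
        ((ig _ _).add intervalIntegrable_const) fun x hx => ?_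
      have := abs_sub_le (deriv g x) (p x) (p a)
      linarith [hclose x hx]
    have h3 := hGg.integral_abs_deriv_sub_le hG hg (p a) hle
    rw [intervalIntegral.integral_add iGa intervalIntegrable_const] at h1
    rw [intervalIntegral.integral_add (ig _ _) intervalIntegrable_const] at h2
    simp only [intervalIntegral.integral_const, smul_eq_mul, add_sub_cancel_left] at h1 h2
    linarith [hηb a (a + τ)]
  have mesh : ∀ n : ℕ, ∫ x in -R..-R + n * τ, |deriv G x - p x| ≤
      (∫ x in -R..-R + n * τ, |deriv g x - p x|) + n * (2 * η + 2 * κ * τ) := by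
    intro n
    induction n with
    | zero => simp
    | succ n ih =>
      have e : -R + ((n + 1 : ℕ) : ℝ) * τ = (-R + n * τ) + τ := by push_cast; ring
      rw [e, ← intervalIntegral.integral_add_adjacent_intervals (iG _ (-R + n * τ)) (iG _ _),
        ← intervalIntegral.integral_add_adjacent_intervals (ig _ (-R + n * τ)) (ig _ _)]
      push_cast
      linarith [cell (-R + n * τ)]
  -- outside the support of `p`
  have outer : ∀ a b : ℝ, a ≤ b → (∀ x ∈ Icc a b, p x = 0) →
      ∫ x in a..b, |deriv G x - p x| ≤ (∫ x in a..b, |deriv g x - p x|) + 2 * η := by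
    intro a b hab h0
    have e : ∀ k : ℝ → ℝ, ∫ x in a..b, |deriv k x - p x| = ∫ x in a..b, |deriv k x - 0| :=
      fun k => intervalIntegral.integral_congr fun x hx => by
        rw [uIcc_of_le hab] at hx
        simp only [h0 x hx]
    rw [e, e]
    linarith [hGg.integral_abs_deriv_sub_le hG hg 0 hab, hηb a b]
  have total : ∀ S : ℝ, 3 * R + 1 ≤ S → ∫ x in -S..S, |deriv G x - p x| ≤
      (∫ x in -S..S, |deriv g x - p x|) + (2 * N + 4) * η + δ := by
    intro S hS
    have o1 := outer (-S) (-R) (by linarith) fun x hx => hsupp x (by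
      rw [abs_of_nonpos (by linarith [hx.2])]; linarith [hx.2])
    have o2 := outer (-R + N * τ) S (by linarith) fun x hx => hsupp x (by
      rw [abs_of_nonneg (by linarith [hx.1])]; linarith [hx.1])
    have h3 : N * (2 * κ * τ) ≤ δ := by
      calc N * (2 * κ * τ) = 2 * κ * (N * τ) := by ring
        _ ≤ 2 * κ * (2 * R + 1) := by gcongr
        _ = δ := by rw [hκ]; field_simp
    rw [← intervalIntegral.integral_add_adjacent_intervals (iG _ (-R)) (iG _ _),
      ← intervalIntegral.integral_add_adjacent_intervals (ig _ (-R)) (ig _ _),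
      ← intervalIntegral.integral_add_adjacent_intervals (iG _ (-R + N * τ)) (iG _ S),
      ← intervalIntegral.integral_add_adjacent_intervals (ig _ (-R + N * τ)) (ig _ S)]
    linarith [mesh N]
  have lim : ∀ k : ℝ → ℝ, Integrable (deriv k) →
      Tendsto (fun S : ℝ => ∫ x in -S..S, |deriv k x - p x|) atTop
        (𝓝 (∫ x, |deriv k x - p x|)) := fun k hk =>
    intervalIntegral_tendsto_integral (hk.sub hpi).abs tendsto_neg_atTop_atBot tendsto_id
  refine le_of_tendsto_of_tendsto (lim G hGi) (((lim g hgi).add_const _).add_const _) ?_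
  filter_upwards [eventually_ge_atTop (3 * R + 1)] with S hS
  exact total S hS

theorem integral_abs_sub_le_add {a b c : ℝ → ℝ} (ha : Integrable a) (hb : Integrable b)
    (hc : Integrable c) : ∫ x, |a x - c x| ≤ (∫ x, |a x - b x|) + ∫ x, |b x - c x| := by
  refine (integral_mono (ha.sub hc).abs ((ha.sub hb).abs.add (hb.sub hc).abs)
    fun x => abs_sub_le (a x) (b x) (c x)).trans_eq ?_
  exact integral_add (ha.sub hb).abs (hb.sub hc).abs

/-- The variation inequality relative to an arbitrary integrable function. -/
theorem exists_integral_abs_deriv_sub_le {w : ℝ → ℝ} (hw : Integrable w) {δ : ℝ} (hδ : 0 < δ) :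
    ∃ K : ℝ, 0 ≤ K ∧ ∀ (G g : ℝ → ℝ) (η : ℝ), ConvexlyDetached G g → LocAC G → LocAC g →
      Integrable (deriv G) → Integrable (deriv g) → (∀ x, G x - g x ≤ η) →
      ∫ x, |deriv G x - w x| ≤ (∫ x, |deriv g x - w x|) + K * η + δ := by
  obtain ⟨p, hc, hwp, hp, hpi⟩ := hw.exists_hasCompactSupport_integral_sub_le
    (show 0 < δ / 3 by linarith)
  obtain ⟨K, hK, h⟩ := exists_integral_abs_deriv_sub_le_of_hasCompactSupport hp hc
    (show 0 < δ / 3 by linarith)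
  refine ⟨K, hK, fun G g η hGg hG hg hGi hgi hη => ?_⟩
  simp only [Real.norm_eq_abs] at hwp
  have h1 := h G g η hGg hG hg hGi hgi hη
  have h2 := integral_abs_sub_le_add hGi hpi hw
  have h3 := integral_abs_sub_le_add hgi hw hpi
  have h4 : ∫ x, |p x - w x| = ∫ x, |w x - p x| := by simp only [abs_sub_comm]
  linarith

/-- Stability of the derivative of convexly detached functions.  The comparison function is
`g = max f₁ (F - ρ)`: it lies between `f₁` and `F₁`, so that `F₁` is convexly detached from it,
and its derivative is close to `F'` because `F' = f'` a.e. on the contact set. -/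
theorem ConvexlyDetached.exists_integral_abs_deriv_sub_le {F f : ℝ → ℝ}
    (h : ConvexlyDetached F f) (hF : LocAC F) (hf : LocAC f) (hFi : Integrable (deriv F))
    (hfi : Integrable (deriv f)) {δ : ℝ} (hδ : 0 < δ) :
    ∃ ρ > 0, ∀ F₁ f₁ : ℝ → ℝ, ConvexlyDetached F₁ f₁ → LocAC F₁ → LocAC f₁ →
      Integrable (deriv F₁) → Integrable (deriv f₁) → (∀ x, |F₁ x - F x| ≤ ρ) →
      (∀ x, |f₁ x - f x| ≤ ρ) → ∫ x, |deriv f₁ x - deriv f x| ≤ ρ →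
      ∫ x, |deriv F₁ x - deriv F x| ≤ δ := by
  obtain ⟨K, hK, hV⟩ := _root_.exists_integral_abs_deriv_sub_le hFi
    (show 0 < δ / 4 by linarith)
  obtain ⟨r, hr, hcontact⟩ := exists_setIntegral_abs_le_of_ae_zero (hF.sub hf).continuous
    (fun x => sub_nonneg.2 (h.le x)) (hfi.sub hFi)
    (by
      filter_upwards [hF.ae_deriv_eq hf] with x hx h0
      simp only [Pi.sub_apply]
      rw [hx (by linarith)]; ring)
    (show 0 < δ / 4 by linarith)
  set ρ := min (r / 2) (min (δ / 4) (δ / (4 * (2 * K + 1))))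
  have hρ0 : 0 < ρ := lt_min (by linarith) (lt_min (by linarith) (by positivity))
  have hρ1 : 2 * ρ ≤ r := by linarith [min_le_left (r / 2) (min (δ / 4) (δ / (4 * (2 * K + 1))))]
  have hρ' := min_le_right (r / 2) (min (δ / 4) (δ / (4 * (2 * K + 1))))
  have hρ2 : ρ ≤ δ / 4 := hρ'.trans (min_le_left _ _)
  have hρ3 : K * (2 * ρ) ≤ δ / 4 := by
    have : ρ ≤ δ / (4 * (2 * K + 1)) := hρ'.trans (min_le_right _ _)
    rw [le_div_iff₀ (by positivity)] at this
    linarith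
  refine ⟨ρ, hρ0, fun F₁ f₁ h₁ hF₁ hf₁ hFi₁ hfi₁ hFF hff hdd => ?_⟩
  set g : ℝ → ℝ := fun x => max (f₁ x) (F x - ρ)
  have hg : LocAC g := hf₁.sup (hF.sub (locAC_const ρ))
  have hFg : ConvexlyDetached F₁ g := by
    refine ⟨fun x => max_le (h₁.le x) ?_, fun x hx => h₁.convex x ?_⟩
    · linarith [(abs_le.1 (hFF x)).1]
    · exact lt_of_le_of_lt (le_max_left _ _) hx
  have hη : ∀ x, F₁ x - g x ≤ 2 * ρ := fun x => by
    have : F x - ρ ≤ g x := le_max_right _ _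
    linarith [(abs_le.1 (hFF x)).2]
  have hgF : ∀ᵐ x, |deriv g x - deriv F x| ≤ |deriv f₁ x - deriv f x| +
      {x | F x - f x ≤ r}.indicator (fun x => |(deriv f - deriv F) x|) x := by
    filter_upwards [hg.ae_deriv_eq hf₁] with x hx
    have hind : 0 ≤ {x | F x - f x ≤ r}.indicator (fun x => |(deriv f - deriv F) x|) x :=
      indicator_nonneg (fun _ _ => abs_nonneg _) _
    rcases lt_or_ge (f₁ x) (F x - ρ) with h1 | h1
    · rw [(deriv_max_sub_const_eq hF.continuous hf₁.continuous).1 h1, sub_self, abs_zero]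
      positivity
    · rw [hx (max_eq_left h1), indicator_of_mem]
      · exact abs_sub_le _ _ _
      · simp only [mem_ofPred_eq]
        linarith [(abs_le.1 (hff x)).2]
  have hmeas : MeasurableSet {x | F x - f x ≤ r} :=
    (isClosed_le (hF.sub hf).continuous continuous_const).measurableSet
  have hbi := (hfi₁.sub hfi).abs.add ((hfi.sub hFi).abs.indicator hmeas)
  have hgi : Integrable (deriv g) := by
    have : Integrable (fun x => deriv g x - deriv F x) :=
      hbi.mono' ((measurable_deriv g).sub (measurable_deriv F)).aestronglyMeasurable hgF
    exact (this.add hFi).congr (Eventually.of_forall fun x => by simp)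
  have h1 : ∫ x, |deriv g x - deriv F x| ≤ δ / 4 + δ / 4 := by
    refine (integral_mono_ae (hgi.sub hFi).abs hbi hgF).trans ?_
    have := integral_add (hfi₁.sub hfi).abs ((hfi.sub hFi).abs.indicator hmeas)
    exact this.trans_le (add_le_add (hdd.trans hρ2) hcontact)
  linarith [hV F₁ g (2 * ρ) hFg hF₁ hg hFi₁ hgi hη]

/-! ### Weak derivatives and absolutely continuous representatives -/

theorem HasCompactSupport.exists_support_subset_Ioc {ψ : ℝ → ℝ} (hc : HasCompactSupport ψ) :
    ∃ R : ℝ, 0 < R ∧ (∀ x, R ≤ |x| → ψ x = 0) ∧ Function.support ψ ⊆ Ioc (-R) R := by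
  obtain ⟨R, hR, hs⟩ := hc.exists_pos_le_norm
  refine ⟨R, hR, hs, fun x hx => ?_⟩
  have : |x| < R := not_le.1 fun h => hx (hs x h)
  exact ⟨(abs_lt.1 this).1, (abs_lt.1 this).2.le⟩

theorem LocAC.isWeakDeriv {f : ℝ → ℝ} (hf : LocAC f) : IsWeakDeriv f (deriv f) := by
  refine ⟨hf.continuous.locallyIntegrable, hf.locallyIntegrable_deriv, fun ψ hψ hc => ?_⟩
  obtain ⟨R, hR, h0, hs⟩ := hc.exists_support_subset_Ioc
  obtain ⟨R', hR', h0', hs'⟩ := hc.deriv.exists_support_subset_Ioc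
  set S := max R R'
  have hψ1 : LocAC ψ := (hψ.of_le (by exact_mod_cast le_top)).locAC
  have key := (hf (-S) S).integral_mul_deriv_eq_deriv_mul (hψ1 (-S) S)
  have hS : R ≤ |S| := (le_max_left R R').trans (le_abs_self _)
  rw [h0 S hS, h0 (-S) (by rwa [abs_neg])] at key
  rw [intervalIntegral.integral_eq_integral_of_support_subset,
    intervalIntegral.integral_eq_integral_of_support_subset] at key
  · rw [key]; ring
  · refine (Function.support_mul_subset_right _ _).trans (hs.trans ?_)
    exact Ioc_subset_Ioc (neg_le_neg (le_max_left _ _)) (le_max_left _ _)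
  · refine (Function.support_mul_subset_right _ _).trans (hs'.trans ?_)
    exact Ioc_subset_Ioc (neg_le_neg (le_max_right _ _)) (le_max_right _ _)

/-- A test function of integral zero is the derivative of a test function. -/
theorem exists_contDiff_deriv_eq {θ : ℝ → ℝ} (hθ : ContDiff ℝ ∞ θ) (hc : HasCompactSupport θ)
    (h0 : ∫ x, θ x = 0) :
    ∃ Θ : ℝ → ℝ, ContDiff ℝ ∞ Θ ∧ HasCompactSupport Θ ∧ deriv Θ = θ := by
  obtain ⟨R, hR, hz, hs⟩ := hc.exists_support_subset_Ioc
  have hd : ∀ x, HasDerivAt (fun x => ∫ t in -R..x, θ t) (θ x) x := fun x =>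
    intervalIntegral.integral_hasDerivAt_right (hθ.continuous.intervalIntegrable _ _)
      (hθ.continuous.stronglyMeasurableAtFilter _ _) hθ.continuous.continuousAt
  have hde : deriv (fun x => ∫ t in -R..x, θ t) = θ := funext fun x => (hd x).deriv
  refine ⟨fun x => ∫ t in -R..x, θ t, ?_, ?_, hde⟩
  · rw [contDiff_infty_iff_deriv, hde]
    exact ⟨fun x => (hd x).differentiableAt, hθ⟩
  · refine HasCompactSupport.intro (isCompact_Icc (a := -R) (b := R)) fun x hx => ?_
    rcases lt_or_ge x (-R) with h | h
    · refine intervalIntegral.integral_zero_ae (Eventually.of_forall fun t ht => hz t ?_)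
      rw [uIoc_of_ge h.le] at ht
      rw [abs_of_nonpos (by linarith [ht.2])]; linarith [ht.2]
    · have hxR : R < x := not_le.1 fun h' => hx ⟨h, h'⟩
      rw [intervalIntegral.integral_eq_integral_of_support_subset, h0]
      exact hs.trans (Ioc_subset_Ioc le_rfl hxR.le)

/-- The lemma of du Bois-Reymond. -/
theorem ae_eq_const_of_integral_mul_deriv_eq_zero {k : ℝ → ℝ}
    (hk : LocallyIntegrable k volume)
    (h : ∀ ψ : ℝ → ℝ, ContDiff ℝ ∞ ψ → HasCompactSupport ψ → ∫ x, k x * deriv ψ x = 0) :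
    ∃ c : ℝ, ∀ᵐ x, k x = c := by
  let b : ContDiffBump (0 : ℝ) := ⟨1, 2, one_pos, one_lt_two⟩
  set ψ₀ : ℝ → ℝ := b.normed volume
  have hψ₀ : ContDiff ℝ ∞ ψ₀ := b.contDiff_normed
  have hc₀ : HasCompactSupport ψ₀ := b.hasCompactSupport_normed
  have hi₀ : ∫ x, ψ₀ x = 1 := b.integral_normed
  have hint : ∀ ψ : ℝ → ℝ, ContDiff ℝ ∞ ψ → HasCompactSupport ψ → Integrable ψ :=
    fun ψ h1 h2 => h1.continuous.integrable_of_hasCompactSupport h2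
  refine ⟨∫ x, k x * ψ₀ x, ?_⟩
  set c := ∫ x, k x * ψ₀ x
  have hz : ∀ᵐ x, k x - c = 0 := by
    refine ae_eq_zero_of_integral_contDiff_smul_eq_zero
      (hk.sub (locallyIntegrable_const c)) fun ψ hψ hc => ?_
    set I := ∫ x, ψ x
    have hθ : ContDiff ℝ ∞ (fun x => ψ x - I * ψ₀ x) := hψ.sub (contDiff_const.mul hψ₀)
    have hθc : HasCompactSupport (fun x => ψ x - I * ψ₀ x) :=
      hc.sub (hc₀.mul_left (f := fun _ => I))
    have hθ0 : ∫ x, (ψ x - I * ψ₀ x) = 0 := by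
      rw [integral_sub (hint ψ hψ hc) ((hint ψ₀ hψ₀ hc₀).const_mul I), integral_const_mul, hi₀]
      ring
    obtain ⟨Θ, hΘ, hΘc, hΘd⟩ := exists_contDiff_deriv_eq hθ hθc hθ0
    have h1 := h Θ hΘ hΘc
    rw [hΘd] at h1
    have i1 := hk.integrable_mul_test hψ.continuous hc
    have i2 := (hk.integrable_mul_test hψ₀.continuous hc₀).const_mul I
    have e1 : ∫ x, k x * (ψ x - I * ψ₀ x) = (∫ x, k x * ψ x) - I * c := by
      rw [← integral_const_mul, ← integral_sub i1 i2]
      exact integral_congr_ae (Eventually.of_forall fun x => by ring)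
    have e2 : ∫ x, ψ x • (k x - c) = (∫ x, k x * ψ x) - I * c := by
      rw [mul_comm I c, ← integral_const_mul, ← integral_sub i1 ((hint ψ hψ hc).const_mul c)]
      exact integral_congr_ae (Eventually.of_forall fun x => by simp only [smul_eq_mul]; ring)
    have e3 := e2.trans (e1.symm.trans h1)
    exact e3
  filter_upwards [hz] with x hx
  linarith

/-- A locally integrable function with a locally integrable weak derivative has a locally
absolutely continuous representative. -/
theorem IsWeakDeriv.exists_locAC {f g : ℝ → ℝ} (h : IsWeakDeriv f g) :
    ∃ F : ℝ → ℝ, LocAC F ∧ f =ᵐ[volume] F ∧ g =ᵐ[volume] deriv F := by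
  have hw := locAC_integral h.2.1 0 0
  have hd := ae_deriv_integral h.2.1 0 0
  set W : ℝ → ℝ := fun x => 0 + ∫ t in (0 : ℝ)..x, g t
  have hW := hw.isWeakDeriv
  obtain ⟨c, hc⟩ := ae_eq_const_of_integral_mul_deriv_eq_zero (h.1.sub hW.1)
    (by
      intro ψ hψ hcs
      have hdc : Continuous (deriv ψ) := hψ.continuous_deriv (by simp)
      simp only [Pi.sub_apply, sub_mul]
      rw [integral_sub (h.1.integrable_mul_test hdc hcs.deriv)
        (hW.1.integrable_mul_test hdc hcs.deriv), h.2.2 ψ hψ hcs, hW.2.2 ψ hψ hcs]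
      have : ∫ x, deriv W x * ψ x = ∫ x, g x * ψ x :=
        integral_congr_ae (by filter_upwards [hd] with x hx; rw [hx])
      rw [this]; ring)
  refine ⟨fun x => W x + c, hw.add (locAC_const c), ?_, ?_⟩
  · filter_upwards [hc] with x hx
    simp only [Pi.sub_apply] at hx
    linarith
  · filter_upwards [hd] with x hx
    rw [deriv_add_const, hx]

theorem LocAC.abs_sub_le_setIntegral {f : ℝ → ℝ} (hf : LocAC f) (x y : ℝ) :
    |f y - f x| ≤ ∫ t in uIoc x y, |deriv f t| := by
  rw [← hf.integral_deriv x y]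
  exact intervalIntegral.norm_integral_le_integral_norm_uIoc (f := deriv f)

theorem LocAC.abs_sub_le {f : ℝ → ℝ} (hf : LocAC f) (hd : Integrable (deriv f)) (x y : ℝ) :
    |f y - f x| ≤ ∫ t, |deriv f t| :=
  (hf.abs_sub_le_setIntegral x y).trans
    (setIntegral_le_integral hd.abs (Eventually.of_forall fun _ => abs_nonneg _))

/-- An integrable function takes arbitrarily small values, so its oscillation controls its
supremum. -/
theorem LocAC.abs_le_integral {f : ℝ → ℝ} (hf : LocAC f) (hi : Integrable f)
    (hd : Integrable (deriv f)) (x : ℝ) : |f x| ≤ ∫ t, |deriv f t| := by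
  refine le_of_forall_pos_le_add fun ε hε => ?_
  obtain ⟨y, hy⟩ : ∃ y, |f y| < ε := by
    by_contra! hcon
    have h1 : Integrable (fun _ : ℝ => ε) :=
      hi.abs.mono' aestronglyMeasurable_const (Eventually.of_forall fun y => by
        rw [Real.norm_eq_abs, abs_of_pos hε]; exact hcon y)
    rw [integrable_const_iff_isFiniteMeasure hε.ne'] at h1
    have := h1.measure_univ_lt_top
    simp at this
  have h1 := hf.abs_sub_le hd y x
  have h2 := abs_sub_abs_le_abs_sub (f x) (f y)
  linarith

theorem LocAC.uniformContinuous {f : ℝ → ℝ} (hf : LocAC f) (hd : Integrable (deriv f)) :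
    UniformContinuous f := by
  rw [Metric.uniformContinuous_iff]
  intro ε hε
  obtain ⟨δ, hδ, h⟩ := exists_pos_setLIntegral_lt_of_measure_lt (μ := volume)
    (f := fun x => ‖deriv f x‖ₑ) hd.2.ne (ENNReal.ofReal_pos.2 hε).ne'
  refine ⟨(min δ 1).toReal, ENNReal.toReal_pos (by positivity) (by simp), fun {a b} hab => ?_⟩
  rw [dist_comm, Real.dist_eq]
  refine (hf.abs_sub_le_setIntegral a b).trans_lt ?_
  have h1 := h (uIoc a b) (by
    rw [Real.volume_uIoc]
    rw [dist_comm, Real.dist_eq, ← ENNReal.ofReal_lt_iff_lt_toReal (abs_nonneg _) (by simp)] at hab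
    exact hab.trans_le (min_le_left _ _))
  have h2 := ofReal_integral_norm_eq_lintegral_enorm (hd.integrableOn (s := uIoc a b))
  rw [← h2] at h1
  exact (ENNReal.ofReal_lt_ofReal_iff hε).1 h1

theorem LocAC.ae_deriv_abs {u : ℝ → ℝ} (hu : LocAC u) :
    ∀ᵐ x, deriv (fun x => |u x|) x = SignType.sign (u x) * deriv u x := by
  filter_upwards [hu.abs.ae_deriv_eq_zero] with x hx
  rcases lt_trichotomy (u x) 0 with h | h | h
  · have : (fun x => |u x|) =ᶠ[𝓝 x] fun x => -u x := by
      filter_upwards [hu.continuous.continuousAt.eventually_lt continuousAt_const h] with y hy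
      exact abs_of_neg hy
    rw [this.deriv_eq, sign_neg h, deriv.fun_neg]; simp
  · rw [hx (by simp [h]), h]; simp
  · have : (fun x => |u x|) =ᶠ[𝓝 x] fun x => u x := by
      filter_upwards [continuousAt_const.eventually_lt hu.continuous.continuousAt h] with y hy
      exact abs_of_pos hy
    rw [this.deriv_eq, sign_pos h]; simp

theorem abs_sign_mul_le (a b : ℝ) : |(SignType.sign a : ℝ) * b| ≤ |b| := by
  rcases lt_trichotomy a 0 with h | h | h
  · simp [sign_neg h]
  · simp [h]
  · simp [sign_pos h]

theorem LocAC.integrable_deriv_abs {u : ℝ → ℝ} (hu : LocAC u) (hd : Integrable (deriv u)) :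
    Integrable (deriv fun x => |u x|) := by
  refine hd.abs.mono' (measurable_deriv _).aestronglyMeasurable ?_
  filter_upwards [hu.ae_deriv_abs] with x hx
  rw [hx]; exact abs_sign_mul_le _ _

/-- The map `u ↦ |u|'` is continuous, because `u' = 0` a.e. on the zero set of `u`. -/
theorem LocAC.exists_integral_abs_deriv_abs_sub_le {u : ℝ → ℝ} (hu : LocAC u)
    (hd : Integrable (deriv u)) {δ : ℝ} (hδ : 0 < δ) :
    ∃ ρ > 0, ∀ u₁ : ℝ → ℝ, LocAC u₁ → Integrable (deriv u₁) → (∀ x, |u₁ x - u x| ≤ ρ) →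
      ∫ x, |deriv u₁ x - deriv u x| ≤ ρ →
      ∫ x, |deriv (fun x => |u₁ x|) x - deriv (fun x => |u x|) x| ≤ δ := by
  obtain ⟨r, hr, hz⟩ := exists_setIntegral_abs_le_of_ae_zero hu.continuous.abs
    (fun x => abs_nonneg (u x)) (hd.const_mul 2)
    (by
      filter_upwards [hu.ae_deriv_eq_zero] with x hx h0
      rw [hx (abs_eq_zero.1 h0), mul_zero])
    (show 0 < δ / 2 by linarith)
  refine ⟨min (r / 2) (δ / 2), lt_min (by linarith) (by linarith),
    fun u₁ hu₁ hd₁ huu hdd => ?_⟩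
  have hmeas : MeasurableSet {x | |u x| ≤ r} :=
    (isClosed_le hu.continuous.abs continuous_const).measurableSet
  have hb : ∀ᵐ x, |deriv (fun x => |u₁ x|) x - deriv (fun x => |u x|) x| ≤
      |deriv u₁ x - deriv u x| + {x | |u x| ≤ r}.indicator (fun x => |2 * deriv u x|) x := by
    filter_upwards [hu.ae_deriv_abs, hu₁.ae_deriv_abs] with x hx hx₁
    rw [hx, hx₁]
    rcases le_or_gt |u x| r with h | h
    · rw [indicator_of_mem (by exact h)]
      have h1 := abs_sign_mul_le (u x) (deriv u x)
      have h2 := abs_sign_mul_le (u₁ x) (deriv u₁ x)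
      have h3 := abs_sub (SignType.sign (u₁ x) * deriv u₁ x) (SignType.sign (u x) * deriv u x)
      have h4 := abs_sub_abs_le_abs_sub (deriv u₁ x) (deriv u x)
      rw [abs_mul, abs_of_pos (show (0 : ℝ) < 2 by norm_num)]
      linarith
    · have hs : SignType.sign (u₁ x) = SignType.sign (u x) := by
        have h1 := abs_le.1 ((huu x).trans (min_le_left _ _))
        rcases lt_abs.1 h with h2 | h2
        · rw [sign_pos (show 0 < u x by linarith), sign_pos (by linarith)]
        · rw [sign_neg (show u x < 0 by linarith), sign_neg (by linarith)]
      rw [indicator_of_notMem (by simpa using h), hs, ← mul_sub, add_zero]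
      exact abs_sign_mul_le _ _
  refine (integral_mono_ae ((hu₁.integrable_deriv_abs hd₁).sub (hu.integrable_deriv_abs hd)).abs
    ((hd₁.sub hd).abs.add ((hd.const_mul 2).abs.indicator hmeas)) hb).trans ?_
  have := integral_add (hd₁.sub hd).abs ((hd.const_mul 2).abs.indicator hmeas)
  refine this.trans_le ?_
  have := hdd.trans (min_le_right _ _)
  calc _ ≤ δ / 2 + δ / 2 := add_le_add this hz
    _ = δ := by ring

/-! ### Maximal functions of kernels with a maximum principle -/

/-- A bounded continuous probability density on the line whose extensions `|u| * φ_t` satisfy the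
maximum principle behind the subharmonicity of the maximal function: at a time `t` maximizing
`(|u| * φ_s)(x)` over `s`, the profile `|u| * φ_t` cannot be touched from above at `x` by a
strictly concave parabola. -/
structure MaxPrincipleKernel (φ : ℝ → ℝ) : Prop where
  continuous : Continuous φ
  nonneg : ∀ x, 0 ≤ φ x
  bounded : ∃ C : ℝ, ∀ x, φ x ≤ C
  integrable : Integrable φ
  integral_eq_one : ∫ x, φ x = 1
  not_isLocalMax : ∀ {u : ℝ → ℝ}, Integrable u → ∀ {x t : ℝ}, 0 < t →
    (∀ s, 0 < s → kernelExtension φ u x s ≤ kernelExtension φ u x t) → ∀ {ε : ℝ}, 0 < ε →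
    ∀ b : ℝ, ¬ IsLocalMax (fun y => kernelExtension φ u y t + ε * y ^ 2 + b * y) x

theorem kernelExtension_eq (φ u : ℝ → ℝ) (x t : ℝ) :
    kernelExtension φ u x t = ∫ y, |u y| * dilatedKernel φ t (x - y) := by
  simp [kernelExtension, convolution]

theorem kernelExtension_eq_integral_comp (φ u : ℝ → ℝ) (x : ℝ) {t : ℝ} (ht : 0 < t) :
    kernelExtension φ u x t = ∫ z, |u (x - t * z)| * φ z := by
  rw [kernelExtension_eq, ← integral_sub_left_eq_self _ volume x]
  have h := Measure.integral_comp_div (fun z => |u (x - t * z)| * φ z) t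
  rw [abs_of_pos ht, smul_eq_mul] at h
  have h2 : ∫ z, |u (x - t * z)| * φ z = t⁻¹ * (t * ∫ z, |u (x - t * z)| * φ z) := by
    field_simp
  rw [h2, ← h, ← integral_const_mul]
  refine integral_congr_ae (Eventually.of_forall fun y => ?_)
  simp only [sub_sub_cancel, dilatedKernel]
  rw [mul_div_cancel₀ _ ht.ne']
  ring

namespace MaxPrincipleKernel

variable {φ : ℝ → ℝ} (hφ : MaxPrincipleKernel φ)

include hφ

theorem integrable_mul_dilatedKernel {v : ℝ → ℝ} (hv : Integrable v) (x t : ℝ) :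
    Integrable (fun y => v y * dilatedKernel φ t (x - y)) := by
  obtain ⟨C, hC⟩ := hφ.bounded
  have hc : Continuous fun y => dilatedKernel φ t (x - y) := by
    have := hφ.continuous
    unfold dilatedKernel
    fun_prop
  refine hv.mul_bdd (c := |t⁻¹| * C) hc.aestronglyMeasurable (Eventually.of_forall fun y => ?_)
  rw [dilatedKernel, Real.norm_eq_abs, abs_mul, abs_of_nonneg (hφ.nonneg _)]
  gcongr
  exact hC _

theorem integrable_abs_comp_mul {u : ℝ → ℝ} (hu : Continuous u) {B : ℝ} (hB : ∀ x, |u x| ≤ B)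
    (x t : ℝ) : Integrable (fun z => |u (x - t * z)| * φ z) := by
  refine hφ.integrable.bdd_mul (c := B) (by fun_prop) (Eventually.of_forall fun y => ?_)
  rw [Real.norm_eq_abs, abs_abs]
  exact hB _

/-- Since `φ` has integral one, the extension is a contraction for the supremum norm.  The two
base points allow for translations of `u` as well as for changes of `u`. -/
theorem abs_kernelExtension_sub_le {u u₁ : ℝ → ℝ} (hu : Continuous u) (hu₁ : Continuous u₁)
    {B : ℝ} (hB : ∀ x, |u x| ≤ B) (hB₁ : ∀ x, |u₁ x| ≤ B) {x x₁ η : ℝ}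
    (h : ∀ z, |u (x - z) - u₁ (x₁ - z)| ≤ η) {t : ℝ} (ht : 0 < t) :
    |kernelExtension φ u x t - kernelExtension φ u₁ x₁ t| ≤ η := by
  rw [kernelExtension_eq_integral_comp φ u x ht, kernelExtension_eq_integral_comp φ u₁ x₁ ht,
    ← integral_sub (hφ.integrable_abs_comp_mul hu hB x t)
      (hφ.integrable_abs_comp_mul hu₁ hB₁ x₁ t)]
  have h1 : ∫ z, η * φ z = η := by rw [integral_const_mul, hφ.integral_eq_one, mul_one]
  rw [← Real.norm_eq_abs]
  refine (norm_integral_le_of_norm_le (hφ.integrable.const_mul η)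
    (Eventually.of_forall fun z => ?_)).trans_eq h1
  rw [← sub_mul, Real.norm_eq_abs, abs_mul, abs_of_nonneg (hφ.nonneg z)]
  exact mul_le_mul_of_nonneg_right ((abs_abs_sub_abs_le_abs_sub _ _).trans (h _)) (hφ.nonneg z)

theorem kernelExtension_le {u : ℝ → ℝ} (hu : Continuous u) {B : ℝ} (hB : ∀ x, |u x| ≤ B)
    (x : ℝ) {t : ℝ} (ht : 0 < t) : kernelExtension φ u x t ≤ B := by
  have h0 : kernelExtension φ (fun _ => 0) x t = 0 := by simp [kernelExtension_eq]
  have hB0 : 0 ≤ B := (abs_nonneg _).trans (hB 0)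
  have h := hφ.abs_kernelExtension_sub_le hu continuous_const (u₁ := fun _ => 0) hB
    (fun _ => by simpa using hB0) (x := x) (x₁ := x) (η := B) (fun z => by simpa using hB _) ht
  rw [h0, sub_zero] at h
  exact (le_abs_self _).trans h

theorem bddAbove {u : ℝ → ℝ} (hu : Continuous u) {B : ℝ} (hB : ∀ x, |u x| ≤ B) (x : ℝ) :
    BddAbove (kernelExtension φ u x '' Ioi 0) := by
  refine ⟨B, ?_⟩
  rintro _ ⟨t, ht, rfl⟩
  exact hφ.kernelExtension_le hu hB x ht

theorem kernelExtension_le_convMaximal {u : ℝ → ℝ} (hu : Continuous u) {B : ℝ}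
    (hB : ∀ x, |u x| ≤ B) (x : ℝ) {t : ℝ} (ht : 0 < t) :
    kernelExtension φ u x t ≤ convMaximal φ u x :=
  le_csSup (hφ.bddAbove hu hB x) ⟨t, ht, rfl⟩

omit hφ in
theorem convMaximal_le {u : ℝ → ℝ} {x M : ℝ}
    (h : ∀ t, 0 < t → kernelExtension φ u x t ≤ M) : convMaximal φ u x ≤ M := by
  refine csSup_le ⟨_, mem_image_of_mem _ (mem_Ioi.2 one_pos)⟩ ?_
  rintro _ ⟨t, ht, rfl⟩
  exact h t ht

theorem abs_convMaximal_sub_le {u u₁ : ℝ → ℝ} (hu : Continuous u) (hu₁ : Continuous u₁)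
    {B : ℝ} (hB : ∀ x, |u x| ≤ B) (hB₁ : ∀ x, |u₁ x| ≤ B) {x x₁ η : ℝ}
    (h : ∀ z, |u (x - z) - u₁ (x₁ - z)| ≤ η) :
    |convMaximal φ u x - convMaximal φ u₁ x₁| ≤ η := by
  have hk := fun t (ht : 0 < t) =>
    abs_le.1 (hφ.abs_kernelExtension_sub_le hu hu₁ hB hB₁ h ht)
  rw [abs_le]
  constructor
  · have : convMaximal φ u₁ x₁ ≤ convMaximal φ u x + η := convMaximal_le fun t ht => by
      linarith [(hk t ht).1, hφ.kernelExtension_le_convMaximal hu hB x ht]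
    linarith
  · have : convMaximal φ u x ≤ convMaximal φ u₁ x₁ + η := convMaximal_le fun t ht => by
      linarith [(hk t ht).2, hφ.kernelExtension_le_convMaximal hu₁ hB₁ x₁ ht]
    linarith

theorem continuous_convMaximal {u : ℝ → ℝ} (hu : UniformContinuous u) {B : ℝ}
    (hB : ∀ x, |u x| ≤ B) : Continuous (convMaximal φ u) := by
  rw [Metric.continuous_iff]
  intro x ε hε
  obtain ⟨δ, hδ, h⟩ := Metric.uniformContinuous_iff.1 hu (ε / 2) (by linarith)
  refine ⟨δ, hδ, fun y hy => ?_⟩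
  rw [Real.dist_eq]
  refine (hφ.abs_convMaximal_sub_le hu.continuous hu.continuous hB hB (η := ε / 2)
    fun z => ?_).trans_lt (by linarith)
  refine (h (a := y - z) (b := x - z) ?_).le
  rwa [dist_sub_right]

theorem continuous_integral_comp_mul {u : ℝ → ℝ} (hu : Continuous u) {B : ℝ}
    (hB : ∀ x, |u x| ≤ B) (x : ℝ) : Continuous fun t => ∫ z, |u (x - t * z)| * φ z := by
  refine continuous_of_dominated (bound := fun z => B * φ z)
    (fun t => (hφ.integrable_abs_comp_mul hu hB x t).aestronglyMeasurable)
    (fun t => Eventually.of_forall fun z => ?_) (hφ.integrable.const_mul B)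
    (Eventually.of_forall fun z => by fun_prop)
  rw [Real.norm_eq_abs, abs_mul, abs_abs, abs_of_nonneg (hφ.nonneg z)]
  exact mul_le_mul_of_nonneg_right (hB _) (hφ.nonneg z)

theorem integral_comp_zero_mul (u : ℝ → ℝ) (x : ℝ) :
    ∫ z, |u (x - 0 * z)| * φ z = |u x| := by
  simp [integral_const_mul, hφ.integral_eq_one]

theorem abs_le_convMaximal {u : ℝ → ℝ} (hu : Continuous u) {B : ℝ} (hB : ∀ x, |u x| ≤ B)
    (x : ℝ) : |u x| ≤ convMaximal φ u x := by
  have h1 := (hφ.continuous_integral_comp_mul hu hB x).tendsto 0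
  rw [hφ.integral_comp_zero_mul] at h1
  refine le_of_tendsto (h1.mono_left (nhdsWithin_le_nhds (s := Ioi 0))) ?_
  filter_upwards [self_mem_nhdsWithin] with t ht
  rw [← kernelExtension_eq_integral_comp φ u x ht]
  exact hφ.kernelExtension_le_convMaximal hu hB x ht

/-- Off the contact set the supremum defining the maximal function is attained. -/
theorem exists_kernelExtension_eq_convMaximal {u : ℝ → ℝ} (hu : Continuous u)
    (hui : Integrable u) {B : ℝ} (hB : ∀ x, |u x| ≤ B) {x : ℝ}
    (hx : |u x| < convMaximal φ u x) :
    ∃ t, 0 < t ∧ kernelExtension φ u x t = convMaximal φ u x := by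
  obtain ⟨C, hC⟩ := hφ.bounded
  set F := convMaximal φ u x
  set H : ℝ → ℝ := fun t => ∫ z, |u (x - t * z)| * φ z
  have hH : Continuous H := hφ.continuous_integral_comp_mul hu hB x
  have hH0 : H 0 = |u x| := hφ.integral_comp_zero_mul u x
  have hEH : ∀ t, 0 < t → kernelExtension φ u x t = H t := fun t ht =>
    kernelExtension_eq_integral_comp φ u x ht
  set M := ∫ y, |u y|
  have hM : 0 ≤ M := integral_nonneg fun _ => abs_nonneg _
  have hC0 : 0 ≤ C := (hφ.nonneg 0).trans (hC 0)
  -- decay as `t → ∞`, which confines the maximizing times to a compact interval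
  have hdecay : ∀ t, 0 < t → t * kernelExtension φ u x t ≤ C * M := by
    intro t ht
    rw [kernelExtension_eq, ← integral_const_mul, ← integral_const_mul]
    refine integral_mono ((hφ.integrable_mul_dilatedKernel hui.abs x t).const_mul t)
      (hui.abs.const_mul C) fun y => ?_
    simp only [dilatedKernel]
    calc t * (|u y| * (t⁻¹ * φ ((x - y) / t))) = φ ((x - y) / t) * |u y| := by field_simp
      _ ≤ C * |u y| := mul_le_mul_of_nonneg_right (hC _) (abs_nonneg _)
  have hF : 0 < F := (abs_nonneg _).trans_lt hx
  obtain ⟨_, ⟨s₀, hs₀, rfl⟩, hs₀F⟩ := exists_lt_of_lt_csSup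
    (s := kernelExtension φ u x '' Ioi 0) ⟨_, mem_image_of_mem _ (mem_Ioi.2 one_pos)⟩
    (show max |u x| (F / 2) < sSup _ from max_lt hx (by linarith [show F = sSup _ from rfl]))
  have hs₀' : 0 < s₀ := hs₀
  have hs1 : |u x| < H s₀ := (le_max_left _ _).trans_lt (hEH s₀ hs₀ ▸ hs₀F)
  have hs2 : F / 2 < H s₀ := (le_max_right _ _).trans_lt (hEH s₀ hs₀ ▸ hs₀F)
  set T := 2 * (C * M) / F
  have hlarge : ∀ s, 0 < s → T ≤ s → H s ≤ F / 2 := by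
    intro s hs hT
    have h1 := hdecay s hs
    rw [div_le_iff₀ hF] at hT
    rw [hEH s hs] at h1
    by_contra! hcon
    nlinarith
  have hs₀T : s₀ ≤ T := by
    by_contra! hcon
    linarith [hlarge s₀ hs₀ hcon.le]
  obtain ⟨t, ht, hmax⟩ := (isCompact_Icc (a := 0) (b := T)).exists_isMaxOn
    ⟨s₀, hs₀'.le, hs₀T⟩ hH.continuousOn
  have hts : H s₀ ≤ H t := hmax ⟨hs₀'.le, hs₀T⟩
  have ht0 : 0 < t := by
    rcases ht.1.eq_or_lt with h | h
    · rw [← h, hH0] at hts; linarith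
    · exact h
  refine ⟨t, ht0, le_antisymm (hφ.kernelExtension_le_convMaximal hu hB x ht0) ?_⟩
  refine convMaximal_le fun s hs => ?_
  rw [hEH s hs, hEH t ht0]
  rcases le_total s T with h | h
  · exact hmax ⟨hs.le, h⟩
  · linarith [hlarge s hs h]

theorem convMaximal_le_chord {u : ℝ → ℝ} (hu : UniformContinuous u) (hui : Integrable u) {B : ℝ}
    (hB : ∀ x, |u x| ≤ B) {c d : ℝ} (hcd : c < d)
    (hx : ∀ x ∈ Icc c d, |u x| < convMaximal φ u x) {x : ℝ} (hxm : x ∈ Icc c d) :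
    convMaximal φ u x ≤ convMaximal φ u c +
      (convMaximal φ u d - convMaximal φ u c) / (d - c) * (x - c) := by
  set F := convMaximal φ u
  have huc := hu.continuous
  have hF : Continuous F := hφ.continuous_convMaximal hu hB
  have hF0 : ∀ x, 0 ≤ F x := fun x => (abs_nonneg _).trans (hφ.abs_le_convMaximal huc hB x)
  have hdc : 0 < d - c := by linarith
  set k := (F d - F c) / (d - c) with hk
  have hkd : k * (d - c) = F d - F c := by rw [hk]; field_simp
  by_contra! hcon
  set γ := F x - (F c + k * (x - c))
  have hγ : 0 < γ := by simp only [γ]; linarith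
  set ε := γ / (2 * (d - c) ^ 2)
  have hε : 0 < ε := by positivity
  -- a strictly concave parabola through the end points, still below `F` at `x`
  set q : ℝ → ℝ := fun y => F c + k * (y - c) + ε * ((y - c) * (d - y)) with hq
  have hqx : 0 < F x - q x := by
    have h1 : (x - c) * (d - x) ≤ (d - c) ^ 2 := by nlinarith [hxm.1, hxm.2]
    have h2 : ε * ((x - c) * (d - x)) ≤ ε * (d - c) ^ 2 := by gcongr
    have h3 : ε * (d - c) ^ 2 = γ / 2 := by simp only [ε]; field_simp
    have h4 : F x - q x = γ - ε * ((x - c) * (d - x)) := by simp only [hq, γ]; ring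
    linarith
  obtain ⟨y, hy, hmax⟩ := (isCompact_Icc (a := c) (b := d)).exists_isMaxOn ⟨x, hxm⟩
    (f := fun y => F y - q y) (by simp only [hq]; fun_prop)
  have hy0 : 0 < F y - q y := hqx.trans_le (hmax hxm)
  have hqc : q c = F c := by simp only [hq]; ring
  have hqd : q d = F d := by simp only [hq]; linarith
  have hyc : c < y := lt_of_le_of_ne hy.1 (by rintro rfl; linarith)
  have hyd : y < d := lt_of_le_of_ne hy.2 (by rintro rfl; linarith)
  obtain ⟨t, ht, hty⟩ := hφ.exists_kernelExtension_eq_convMaximal huc hui hB (hx y hy)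
  refine hφ.not_isLocalMax hui ht (fun s hs => ?_) hε (-(k + ε * (c + d))) ?_ (x := y)
  · rw [hty]; exact hφ.kernelExtension_le_convMaximal huc hB y hs
  · filter_upwards [Icc_mem_nhds hyc hyd] with z hz
    have h1 : F z - q z ≤ F y - q y := hmax hz
    have h2 := hφ.kernelExtension_le_convMaximal huc hB z ht
    rw [hty]
    simp only [hq] at h1
    change kernelExtension φ u z t ≤ F z at h2
    change _ ≤ F y + _ + _
    nlinarith

/-- The maximal function is subharmonic, that is convex, off the contact set. -/
theorem convexlyDetached {u : ℝ → ℝ} (hu : UniformContinuous u) (hui : Integrable u) {B : ℝ}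
    (hB : ∀ x, |u x| ≤ B) : ConvexlyDetached (convMaximal φ u) (fun x => |u x|) := by
  have huc := hu.continuous
  refine ⟨hφ.abs_le_convMaximal huc hB, fun x hx => ?_⟩
  obtain ⟨r, hr, hsub⟩ := Metric.mem_nhds_iff.1
    ((isOpen_lt huc.abs (hφ.continuous_convMaximal hu hB)).mem_nhds hx)
  rw [Real.ball_eq_Ioo] at hsub
  refine ⟨r, hr, LinearOrder.convexOn_of_lt (convex_Ioo _ _) fun c hc d hd hcd a b ha hb hab => ?_⟩
  have hm : a * c + b * d ∈ Icc c d := by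
    obtain rfl : a = 1 - b := by linarith
    constructor <;> nlinarith
  have h := hφ.convMaximal_le_chord hu hui hB hcd
    (fun z hz => hsub ⟨hc.1.trans_le hz.1, hz.2.trans_lt hd.2⟩) hm
  have e : (convMaximal φ u d - convMaximal φ u c) / (d - c) * (a * c + b * d - c) =
      b * (convMaximal φ u d - convMaximal φ u c) := by
    have hdc : d - c ≠ 0 := by linarith
    obtain rfl : a = 1 - b := by linarith
    field_simp
    ring
  rw [e] at h
  simp only [smul_eq_mul]
  obtain rfl : a = 1 - b := by linarith
  linarith

end MaxPrincipleKernel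

/-! ### Differentiation under the integral sign -/

/-- The necessary second-order condition at a local maximum. -/
theorem IsLocalMax.second_deriv_nonpos {f f₁ : ℝ → ℝ} {x f₂ : ℝ} (hmax : IsLocalMax f x)
    (h₁ : ∀ᶠ y in 𝓝 x, HasDerivAt f (f₁ y) y) (h₂ : HasDerivAt f₁ f₂ x) : f₂ ≤ 0 := by
  by_contra! hpos
  have e1 : deriv f =ᶠ[𝓝 x] f₁ := h₁.mono fun y hy => hy.deriv
  have hd : deriv (deriv f) x = f₂ := e1.deriv_eq.trans h₂.deriv
  have hmin := isLocalMin_of_deriv_deriv_pos (by rw [hd]; exact hpos) hmax.deriv_eq_zero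
    h₁.self_of_nhds.continuousAt
  have hconst : f =ᶠ[𝓝 x] fun _ => f x := by
    filter_upwards [hmax, hmin] with y h1 h2 using le_antisymm h1 h2
  have h0 : deriv (deriv f) x = 0 := by
    have e2 : deriv f =ᶠ[𝓝 x] fun _ => 0 := hconst.deriv.trans (by simp)
    rw [e2.deriv_eq]; simp
  linarith

theorem MeasureTheory.Integrable.mul_of_abs_le {w k : ℝ → ℝ} (hw : Integrable w)
    (hk : Continuous k) {C : ℝ} (h : ∀ y, |k y| ≤ C) : Integrable (fun y => w y * k y) :=
  hw.mul_bdd hk.aestronglyMeasurable (Eventually.of_forall h)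

/-- Differentiation under the integral sign against an integrable weight. -/
theorem hasDerivAt_integral_mul {w : ℝ → ℝ} (hw : Integrable w) {K K' : ℝ → ℝ → ℝ}
    {s r B C : ℝ} (hr : 0 < r)
    (hK : ∀ a ∈ Metric.ball s r, ∀ y, HasDerivAt (fun a => K a y) (K' a y) a)
    (hb : ∀ a ∈ Metric.ball s r, ∀ y, |K' a y| ≤ C)
    (hc : ∀ a ∈ Metric.ball s r, Continuous (K a)) (hB : ∀ y, |K s y| ≤ B)
    (hc' : Continuous (K' s)) :
    HasDerivAt (fun a => ∫ y, w y * K a y) (∫ y, w y * K' s y) s := by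
  have hball := Metric.ball_mem_nhds s hr
  refine (hasDerivAt_integral_of_dominated_loc_of_deriv_le (F := fun a y => w y * K a y)
    (F' := fun a y => w y * K' a y) (bound := fun y => |w y| * C) hball ?_
    (hw.mul_of_abs_le (hc s (Metric.mem_ball_self hr)) hB)
    (hw.aestronglyMeasurable.mul hc'.aestronglyMeasurable) ?_ (hw.abs.mul_const C) ?_).2
  · filter_upwards [hball] with a ha
    exact hw.aestronglyMeasurable.mul (hc a ha).aestronglyMeasurable
  · refine Eventually.of_forall fun y a ha => ?_
    rw [Real.norm_eq_abs, abs_mul]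
    exact mul_le_mul_of_nonneg_left (hb a ha y) (abs_nonneg _)
  · exact Eventually.of_forall fun y a ha => (hK a ha y).const_mul _

theorem hasDerivAt_integral_mul_sub {w : ℝ → ℝ} (hw : Integrable w) {k k' : ℝ → ℝ} {B C : ℝ}
    (hk : ∀ z, HasDerivAt k (k' z) z) (hB : ∀ z, |k z| ≤ B) (hC : ∀ z, |k' z| ≤ C)
    (hc : Continuous k') (x : ℝ) :
    HasDerivAt (fun x => ∫ y, w y * k (x - y)) (∫ y, w y * k' (x - y)) x := by
  have hkc : Continuous k := continuous_iff_continuousAt.2 fun z => (hk z).continuousAt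
  refine hasDerivAt_integral_mul hw (K := fun x y => k (x - y)) (K' := fun x y => k' (x - y))
    one_pos (fun a _ y => ?_) (fun a _ y => hC _) (fun a _ => by fun_prop) (fun y => hB _)
    (by fun_prop)
  exact (hk (a - y)).comp_sub_const a y

/-- The spatial second-derivative test for `c (w * k) + ε x² + b x`, where `w * k` is the
convolution. -/
theorem integral_second_deriv_neg {w : ℝ → ℝ} (hw : Integrable w) {k k' k'' : ℝ → ℝ}
    {B B' B'' : ℝ} (hk : ∀ z, HasDerivAt k (k' z) z) (hk' : ∀ z, HasDerivAt k' (k'' z) z)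
    (hB : ∀ z, |k z| ≤ B) (hB' : ∀ z, |k' z| ≤ B') (hB'' : ∀ z, |k'' z| ≤ B'')
    (hc : Continuous k'') {c ε b x : ℝ} (hcp : 0 ≤ c) (hε : 0 < ε)
    (hmax : IsLocalMax (fun x => c * (∫ y, w y * k (x - y)) + ε * x ^ 2 + b * x) x) :
    ∫ y, w y * k'' (x - y) < 0 := by
  have hc' : Continuous k' := continuous_iff_continuousAt.2 fun z => (hk' z).continuousAt
  have h1 : ∀ z, HasDerivAt (fun x => c * (∫ y, w y * k (x - y)) + ε * x ^ 2 + b * x)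
      (c * (∫ y, w y * k' (z - y)) + ε * (2 * z) + b) z := fun z => by
    have := (((hasDerivAt_integral_mul_sub hw hk hB hB' hc' z).const_mul c).fun_add
      ((hasDerivAt_pow 2 z).const_mul ε)).fun_add ((hasDerivAt_id' z).const_mul b)
    exact this.congr_deriv (by norm_num)
  have h2 : HasDerivAt (fun z => c * (∫ y, w y * k' (z - y)) + ε * (2 * z) + b)
      (c * (∫ y, w y * k'' (x - y)) + ε * 2) x := by
    have := (((hasDerivAt_integral_mul_sub hw hk' hB' hB'' hc x).const_mul c).fun_add
      (((hasDerivAt_id' x).const_mul 2).const_mul ε)).add_const b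
    exact this.congr_deriv (by norm_num)
  have h3 := hmax.second_deriv_nonpos (Eventually.of_forall h1) h2
  by_contra! hcon
  nlinarith [mul_nonneg hcp hcon]

/-! ### The heat kernel -/

theorem mul_exp_neg_le_one (y : ℝ) : y * Real.exp (-y) ≤ 1 := by
  rw [Real.exp_neg, ← div_eq_mul_inv, div_le_one (Real.exp_pos _)]
  linarith [Real.add_one_le_exp y]

theorem kernelExtension_lineKernelHeat (u : ℝ → ℝ) (x : ℝ) {t : ℝ} (ht : 0 < t) :
    kernelExtension lineKernelHeat u x t =
      (t⁻¹ * (1 / Real.sqrt (4 * Real.pi))) *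
        ∫ y, |u y| * Real.exp (-(x - y) ^ 2 / (4 * t ^ 2)) := by
  rw [kernelExtension_eq, ← integral_const_mul]
  refine integral_congr_ae (Eventually.of_forall fun y => ?_)
  simp only [dilatedKernel, lineKernelHeat]
  have : -((x - y) / t) ^ 2 / 4 = -(x - y) ^ 2 / (4 * t ^ 2) := by field_simp
  rw [this]; ring

/-- At a maximizing time `∂ₜ = 0`, so that `∂ₓₓ = 0` by the heat equation. -/
theorem not_isLocalMax_lineKernelHeat {u : ℝ → ℝ} (hu : Integrable u) {x t : ℝ} (ht : 0 < t)
    (hmax : ∀ s, 0 < s →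
      kernelExtension lineKernelHeat u x s ≤ kernelExtension lineKernelHeat u x t)
    {ε : ℝ} (hε : 0 < ε) (b : ℝ) :
    ¬ IsLocalMax (fun y => kernelExtension lineKernelHeat u y t + ε * y ^ 2 + b * y) x := by
  intro hloc
  have hw := hu.abs
  have hsq : 0 < Real.sqrt (4 * Real.pi) := by positivity
  -- the spatial condition
  have hexp1 : ∀ z : ℝ, Real.exp (-z ^ 2 / (4 * t ^ 2)) ≤ 1 := fun z => by
    rw [Real.exp_le_one_iff]
    exact div_nonpos_of_nonpos_of_nonneg (by nlinarith [sq_nonneg z]) (by positivity)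
  have hzz : ∀ s z : ℝ, 0 < s →
      z ^ 2 / (4 * s ^ 2) * Real.exp (-z ^ 2 / (4 * s ^ 2)) ≤ 1 := fun s z _ => by
    rw [neg_div]; exact mul_exp_neg_le_one _
  have hk : ∀ z, HasDerivAt (fun z : ℝ => Real.exp (-z ^ 2 / (4 * t ^ 2)))
      (-(z / (2 * t ^ 2)) * Real.exp (-z ^ 2 / (4 * t ^ 2))) z := fun z => by
    have := ((hasDerivAt_pow 2 z).fun_neg.div_const (4 * t ^ 2)).exp
    refine this.congr_deriv ?_
    norm_num
    field_simp
    ring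
  have hk' : ∀ z, HasDerivAt (fun z : ℝ => -(z / (2 * t ^ 2)) * Real.exp (-z ^ 2 / (4 * t ^ 2)))
      ((z ^ 2 / (4 * t ^ 4) - 1 / (2 * t ^ 2)) * Real.exp (-z ^ 2 / (4 * t ^ 2))) z := fun z => by
    have := ((hasDerivAt_id' z).div_const (2 * t ^ 2)).fun_neg.fun_mul (hk z)
    refine this.congr_deriv ?_
    field_simp
    ring
  have hx := integral_second_deriv_neg hw (B := 1) (B' := (1 + 1 / (4 * t ^ 2)))
    (B'' := 1 / t ^ 2 + 1 / (2 * t ^ 2)) (x := x) (b := b)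
    (c := t⁻¹ * (1 / Real.sqrt (4 * Real.pi))) hk hk'
    (fun z => by rw [abs_of_pos (Real.exp_pos _)]; exact hexp1 z)
    (fun z => by
      rw [abs_mul, abs_of_pos (Real.exp_pos _), abs_neg]
      have h1 : |z / (2 * t ^ 2)| ≤ z ^ 2 / (4 * t ^ 2) + 1 / (4 * t ^ 2) := by
        rw [abs_div, abs_of_pos (show 0 < 2 * t ^ 2 by positivity), ← add_div,
          div_le_div_iff₀ (by positivity) (by positivity)]
        nlinarith [sq_nonneg (|z| - 1), sq_abs z, sq_nonneg t,
          mul_nonneg (sq_nonneg t) (sq_nonneg (|z| - 1))]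
      calc _ ≤ (z ^ 2 / (4 * t ^ 2) + 1 / (4 * t ^ 2)) * Real.exp (-z ^ 2 / (4 * t ^ 2)) := by
            gcongr
        _ ≤ 1 + 1 / (4 * t ^ 2) := by
            rw [add_mul]
            exact add_le_add (hzz t z ht)
              (mul_le_of_le_one_right (by positivity) (hexp1 z)))
    (fun z => by
      rw [sub_mul]
      refine (abs_sub _ _).trans ?_
      rw [abs_of_nonneg (by positivity), abs_of_nonneg (by positivity)]
      refine add_le_add ?_ (mul_le_of_le_one_right (by positivity) (hexp1 z))
      have : z ^ 2 / (4 * t ^ 4) * Real.exp (-z ^ 2 / (4 * t ^ 2)) =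
          1 / t ^ 2 * (z ^ 2 / (4 * t ^ 2) * Real.exp (-z ^ 2 / (4 * t ^ 2))) := by field_simp
      rw [this]
      exact mul_le_of_le_one_right (by positivity) (hzz t z ht))
    (by fun_prop) (by positivity) hε
    (by simpa only [kernelExtension_lineKernelHeat u _ ht] using hloc)
  -- the temporal condition
  set J : ℝ → ℝ := fun s => ∫ y, |u y| * Real.exp (-(x - y) ^ 2 / (4 * s ^ 2))
  set P : ℝ := ∫ y, |u y| * ((x - y) ^ 2 / (2 * t ^ 3) * Real.exp (-(x - y) ^ 2 / (4 * t ^ 2)))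
  have hJ : HasDerivAt J P t := by
    refine hasDerivAt_integral_mul hw (r := t / 2) (B := 1) (C := 4 / t)
      (K := fun s y => Real.exp (-(x - y) ^ 2 / (4 * s ^ 2)))
      (K' := fun s y => (x - y) ^ 2 / (2 * s ^ 3) * Real.exp (-(x - y) ^ 2 / (4 * s ^ 2)))
      (by linarith) ?_ ?_ ?_ ?_ (by fun_prop)
    · intro s hs y
      rw [Real.ball_eq_Ioo] at hs
      have hs0 : s ≠ 0 := by linarith [hs.1]
      have := ((hasDerivAt_const s (-(x - y) ^ 2)).fun_div ((hasDerivAt_pow 2 s).const_mul 4)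
        (by positivity)).exp
      refine this.congr_deriv ?_
      norm_num
      field_simp
      ring
    · intro s hs y
      rw [Real.ball_eq_Ioo] at hs
      have hs0 : 0 < s := by linarith [hs.1]
      rw [abs_of_nonneg (by positivity)]
      have : (x - y) ^ 2 / (2 * s ^ 3) * Real.exp (-(x - y) ^ 2 / (4 * s ^ 2)) =
          2 / s * ((x - y) ^ 2 / (4 * s ^ 2) * Real.exp (-(x - y) ^ 2 / (4 * s ^ 2))) := by
        field_simp; ring
      rw [this]
      refine (mul_le_of_le_one_right (by positivity) (hzz s (x - y) hs0)).trans ?_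
      rw [div_le_div_iff₀ hs0 ht]
      linarith [hs.1]
    · intro s hs
      fun_prop
    · intro y
      rw [abs_of_pos (Real.exp_pos _)]; exact hexp1 _
  have hd : HasDerivAt (fun s => s⁻¹ * J s) (-(t ^ 2)⁻¹ * J t + t⁻¹ * P) t :=
    (hasDerivAt_inv ht.ne').mul hJ
  have hlm : IsLocalMax (fun s => s⁻¹ * J s) t := by
    filter_upwards [lt_mem_nhds ht] with s hs
    have := hmax s hs
    rw [kernelExtension_lineKernelHeat u x hs, kernelExtension_lineKernelHeat u x ht] at this
    have h2 : (1 / Real.sqrt (4 * Real.pi)) * (s⁻¹ * J s) ≤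
        (1 / Real.sqrt (4 * Real.pi)) * (t⁻¹ * J t) := by
      simp only [J]; linarith
    exact le_of_mul_le_mul_left h2 (by positivity)
  have h0 := hlm.hasDerivAt_eq_zero hd
  have hP : t * P = J t := by
    have : t ^ 2 * (-(t ^ 2)⁻¹ * J t + t⁻¹ * P) = t * P - J t := by field_simp; ring
    rw [h0, mul_zero] at this; linarith
  have hPi : Integrable (fun y => |u y| *
      ((x - y) ^ 2 / (2 * t ^ 3) * Real.exp (-(x - y) ^ 2 / (4 * t ^ 2)))) := by
    refine hw.mul_of_abs_le (by fun_prop) (C := 2 / t) fun y => ?_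
    rw [abs_of_nonneg (by positivity)]
    have : (x - y) ^ 2 / (2 * t ^ 3) * Real.exp (-(x - y) ^ 2 / (4 * t ^ 2)) =
        2 / t * ((x - y) ^ 2 / (4 * t ^ 2) * Real.exp (-(x - y) ^ 2 / (4 * t ^ 2))) := by
      field_simp; ring
    rw [this]
    exact mul_le_of_le_one_right (by positivity) (hzz t (x - y) ht)
  have hJi : Integrable (fun y => |u y| * Real.exp (-(x - y) ^ 2 / (4 * t ^ 2))) :=
    hw.mul_of_abs_le (by fun_prop) (C := 1) fun y => by
      rw [abs_of_pos (Real.exp_pos _)]; exact hexp1 _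
  have hxx : ∫ y, |u y| * (((x - y) ^ 2 / (4 * t ^ 4) - 1 / (2 * t ^ 2)) *
      Real.exp (-(x - y) ^ 2 / (4 * t ^ 2))) = 1 / (2 * t) * P - 1 / (2 * t ^ 2) * J t := by
    rw [← integral_const_mul, ← integral_const_mul,
      ← integral_sub (hPi.const_mul _) (hJi.const_mul _)]
    refine integral_congr_ae (Eventually.of_forall fun y => ?_)
    simp only
    field_simp
    ring
  rw [hxx, ← hP] at hx
  have : 1 / (2 * t) * P - 1 / (2 * t ^ 2) * (t * P) = 0 := by field_simp; ring
  linarith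

theorem maxPrincipleKernel_heat : MaxPrincipleKernel lineKernelHeat where
  continuous := by unfold lineKernelHeat; fun_prop
  nonneg x := by unfold lineKernelHeat; positivity
  bounded := by
    refine ⟨1 / Real.sqrt (4 * Real.pi), fun x => mul_le_of_le_one_right (by positivity) ?_⟩
    rw [Real.exp_le_one_iff]
    nlinarith [sq_nonneg x]
  integrable := by
    have := (integrable_exp_neg_mul_sq (show (0 : ℝ) < 1 / 4 by norm_num)).const_mul
      (1 / Real.sqrt (4 * Real.pi))
    refine this.congr (Eventually.of_forall fun x => ?_)
    simp only [lineKernelHeat]; ring_nf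
  integral_eq_one := by
    have h := integral_gaussian (1 / 4)
    have e : ∀ x : ℝ, lineKernelHeat x =
        1 / Real.sqrt (4 * Real.pi) * Real.exp (-(1 / 4) * x ^ 2) := fun x => by
      simp only [lineKernelHeat]; ring_nf
    simp only [e]
    rw [integral_const_mul, h, show Real.pi / (1 / 4) = 4 * Real.pi by ring]
    exact one_div_mul_cancel (by positivity)
  not_isLocalMax hu _ _ ht hmax _ hε b := not_isLocalMax_lineKernelHeat hu ht hmax hε b

/-! ### The fractional Poisson kernel -/

/-- The potential `J_γ(x, s) = ∫ w(y) ((x - y)² + s)^{-γ} dy`. -/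
noncomputable def sqPotential (w : ℝ → ℝ) (γ x s : ℝ) : ℝ := ∫ y, w y * ((x - y) ^ 2 + s) ^ (-γ)

theorem continuous_sq_add_rpow {s : ℝ} (hs : 0 < s) (γ : ℝ) :
    Continuous fun z : ℝ => (z ^ 2 + s) ^ γ :=
  Continuous.rpow_const (by fun_prop) fun z => Or.inl (by positivity)

theorem sq_add_rpow_neg_le {s σ γ : ℝ} (hσ : 0 < σ) (hs : σ ≤ s) (hγ : 0 ≤ γ) (z : ℝ) :
    |(z ^ 2 + s) ^ (-γ)| ≤ σ ^ (-γ) := by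
  have h1 : 0 ≤ z ^ 2 + s := by nlinarith [sq_nonneg z]
  rw [abs_of_nonneg (Real.rpow_nonneg h1 _)]
  exact Real.rpow_le_rpow_of_nonpos hσ (by nlinarith [sq_nonneg z]) (by linarith)

theorem integrable_mul_sq_add_rpow {w : ℝ → ℝ} (hw : Integrable w) {s γ : ℝ} (hs : 0 < s)
    (hγ : 0 ≤ γ) (x : ℝ) : Integrable fun y => w y * ((x - y) ^ 2 + s) ^ (-γ) :=
  hw.mul_of_abs_le ((continuous_sq_add_rpow hs _).comp (by fun_prop : Continuous fun y => x - y))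
    fun _ => sq_add_rpow_neg_le hs le_rfl hγ _

theorem hasDerivAt_sqPotential {w : ℝ → ℝ} (hw : Integrable w) {s γ : ℝ} (hs : 0 < s)
    (hγ : 0 ≤ γ) (x : ℝ) :
    HasDerivAt (sqPotential w γ x) (-γ * sqPotential w (γ + 1) x s) s := by
  have hpos : ∀ a ∈ Metric.ball s (s / 2), s / 2 ≤ a := fun a ha => by
    rw [Real.ball_eq_Ioo] at ha; linarith [ha.1]
  have h := hasDerivAt_integral_mul hw (s := s) (r := s / 2) (B := s ^ (-γ))
    (C := γ * (s / 2) ^ (-(γ + 1)))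
    (K := fun a y => ((x - y) ^ 2 + a) ^ (-γ))
    (K' := fun a y => -γ * ((x - y) ^ 2 + a) ^ (-(γ + 1))) (by linarith)
    (fun a ha y => by
      have hp : 0 < (x - y) ^ 2 + a := by nlinarith [sq_nonneg (x - y), hpos a ha]
      have := ((hasDerivAt_id' a).const_add ((x - y) ^ 2)).rpow_const (p := -γ) (Or.inl hp.ne')
      refine this.congr_deriv ?_
      rw [one_mul, show -γ - 1 = -(γ + 1) by ring])
    (fun a ha y => by
      rw [abs_mul, abs_neg, abs_of_nonneg hγ]
      exact mul_le_mul_of_nonneg_left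
        (sq_add_rpow_neg_le (by linarith) (hpos a ha) (by linarith) _) hγ)
    (fun a ha => (continuous_sq_add_rpow (by linarith [hpos a ha]) _).comp
      (by fun_prop : Continuous fun y => x - y))
    (fun y => sq_add_rpow_neg_le hs le_rfl hγ _)
    (continuous_const.mul ((continuous_sq_add_rpow hs _).comp
      (by fun_prop : Continuous fun y => x - y)))
  refine h.congr_deriv ?_
  rw [sqPotential, ← integral_const_mul]
  exact integral_congr_ae (Eventually.of_forall fun y => by ring)

/-- With `A = z² + s`, the derivatives of `A^{-β}` in `z`; `z²` is written as `A - s` in the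
second one. -/
theorem hasDerivAt_sq_add_rpow {s β : ℝ} (hs : 0 < s) (z : ℝ) :
    HasDerivAt (fun z : ℝ => (z ^ 2 + s) ^ (-β)) (-2 * β * z * (z ^ 2 + s) ^ (-(β + 1))) z ∧
    HasDerivAt (fun z : ℝ => -2 * β * z * (z ^ 2 + s) ^ (-(β + 1)))
      (2 * β * (2 * β + 1) * (z ^ 2 + s) ^ (-(β + 1)) -
        4 * β * (β + 1) * s * (z ^ 2 + s) ^ (-(β + 2))) z := by
  have hp : 0 < z ^ 2 + s := by positivity
  have hd : ∀ γ, HasDerivAt (fun z : ℝ => (z ^ 2 + s) ^ (-γ))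
      (-2 * γ * z * (z ^ 2 + s) ^ (-(γ + 1))) z := fun γ => by
    have := ((hasDerivAt_pow 2 z).add_const s).rpow_const (p := -γ) (Or.inl hp.ne')
    refine this.congr_deriv ?_
    rw [show -γ - 1 = -(γ + 1) by ring]
    push_cast
    ring
  refine ⟨hd β, ?_⟩
  have := ((hasDerivAt_id' z).const_mul (-2 * β)).fun_mul (hd (β + 1))
  refine this.congr_deriv ?_
  have e : (z ^ 2 + s) ^ (-(β + 1)) = (z ^ 2 + s) * (z ^ 2 + s) ^ (-(β + 2)) := by
    rw [show -(β + 1) = 1 + -(β + 2) by ring, Real.rpow_add hp, Real.rpow_one]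
  rw [show β + 1 + 1 = β + 2 by ring, e]
  ring

theorem lineKernelFractional_dilated (α : ℝ) {t : ℝ} (ht : 0 < t) (z : ℝ) :
    dilatedKernel (lineKernelFractional α) t z =
      (∫ y : ℝ, 1 / (y ^ 2 + 1) ^ ((2 - α) / 2))⁻¹ *
        ((t ^ 2) ^ ((1 - α) / 2) * (z ^ 2 + t ^ 2) ^ (-((2 - α) / 2))) := by
  have h1 : (z / t) ^ 2 + 1 = (z ^ 2 + t ^ 2) * (t ^ 2)⁻¹ := by field_simp
  have ht2 : 0 < t ^ 2 := by positivity
  have h2 : t⁻¹ = (t ^ 2) ^ (-(1 / 2) : ℝ) := by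
    rw [Real.rpow_neg ht2.le, ← Real.sqrt_eq_rpow, Real.sqrt_sq ht.le]
  have h3 : (t ^ 2) ^ ((1 - α) / 2) = (t ^ 2) ^ (-(1 / 2) : ℝ) * (t ^ 2) ^ ((2 - α) / 2) := by
    rw [← Real.rpow_add ht2]; congr 1; ring
  simp only [dilatedKernel, lineKernelFractional]
  rw [h1, Real.mul_rpow (by positivity) (by positivity), Real.inv_rpow ht2.le,
    Real.rpow_neg (by positivity), h3, h2]
  have h4 : 0 < (t ^ 2) ^ ((2 - α) / 2) := by positivity
  have h5 : 0 < (z ^ 2 + t ^ 2) ^ ((2 - α) / 2) := by positivity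
  field_simp

theorem integrable_fractional {α : ℝ} (hα : α < 1) :
    Integrable fun y : ℝ => 1 / (y ^ 2 + 1) ^ ((2 - α) / 2) := by
  have h := integrable_rpow_neg_one_add_norm_sq (E := ℝ) (μ := volume) (r := 2 - α)
    (by simp; linarith)
  refine h.congr (Eventually.of_forall fun y => ?_)
  simp only
  rw [Real.norm_eq_abs, sq_abs, neg_div, Real.rpow_neg (by positivity), add_comm, one_div]

theorem integral_fractional_pos {α : ℝ} (hα : α < 1) :
    0 < ∫ y : ℝ, 1 / (y ^ 2 + 1) ^ ((2 - α) / 2) := by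
  have hp : ∀ y : ℝ, 0 < 1 / (y ^ 2 + 1) ^ ((2 - α) / 2) := fun y => by positivity
  rw [integral_pos_iff_support_of_nonneg (fun y => (hp y).le) (integrable_fractional hα)]
  have : Function.support (fun y : ℝ => 1 / (y ^ 2 + 1) ^ ((2 - α) / 2)) = univ :=
    eq_univ_of_forall fun y => (hp y).ne'
  rw [this]; simp

theorem kernelExtension_lineKernelFractional (α : ℝ) (u : ℝ → ℝ) (x : ℝ) {t : ℝ} (ht : 0 < t) :
    kernelExtension (lineKernelFractional α) u x t =
      (∫ y : ℝ, 1 / (y ^ 2 + 1) ^ ((2 - α) / 2))⁻¹ * ((t ^ 2) ^ ((1 - α) / 2) *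
        sqPotential (fun y => |u y|) ((2 - α) / 2) x (t ^ 2)) := by
  rw [kernelExtension_eq, sqPotential, ← integral_const_mul, ← integral_const_mul]
  refine integral_congr_ae (Eventually.of_forall fun y => ?_)
  simp only
  rw [lineKernelFractional_dilated α ht]
  ring

/-- With `s = t²`, `a = (1 - α)/2` and `β = a + 1/2`, the extension is a multiple of `s^a J_β`,
with `∂ₛ (s^a J_β) = s^{a-1} W` for `W = a J_β - β s J_{β+1}`, and `∂ₓₓ J_β = -4 ∂ₛ W`.  At a
maximizing `s` one has `W = 0` and `∂ₛ W ≤ 0`, hence `∂ₓₓ J_β ≥ 0`. -/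
theorem not_isLocalMax_lineKernelFractional {α : ℝ} (hα1 : α < 1) {u : ℝ → ℝ}
    (hu : Integrable u) {x t : ℝ} (ht : 0 < t)
    (hmax : ∀ s, 0 < s → kernelExtension (lineKernelFractional α) u x s ≤
      kernelExtension (lineKernelFractional α) u x t)
    {ε : ℝ} (hε : 0 < ε) (b : ℝ) :
    ¬ IsLocalMax (fun y => kernelExtension (lineKernelFractional α) u y t + ε * y ^ 2 + b * y)
      x := by
  intro hloc
  have hw := hu.abs
  set w := fun y => |u y|
  set c := (∫ y : ℝ, 1 / (y ^ 2 + 1) ^ ((2 - α) / 2))⁻¹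
  have hc : 0 < c := inv_pos.2 (integral_fractional_pos hα1)
  set β := (2 - α) / 2 with hβ
  set a := (1 - α) / 2 with ha
  have hβa : β = a + 1 / 2 := by rw [hβ, ha]; ring
  have hβ0 : 0 < β := by linarith
  set s₁ := t ^ 2
  have hs₁ : 0 < s₁ := by positivity
  set J := fun γ => sqPotential w γ x
  -- the spatial condition
  have hx := integral_second_deriv_neg hw (B := s₁ ^ (-β))
    (B' := β * (s₁ ^ (-β) + s₁ ^ (-(β + 1))))
    (B'' := 2 * β * (2 * β + 1) * s₁ ^ (-(β + 1)) + 4 * β * (β + 1) * s₁ * s₁ ^ (-(β + 2)))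
    (x := x) (b := b) (c := c * s₁ ^ a)
    (fun z => (hasDerivAt_sq_add_rpow (β := β) hs₁ z).1)
    (fun z => (hasDerivAt_sq_add_rpow (β := β) hs₁ z).2)
    (fun z => sq_add_rpow_neg_le hs₁ le_rfl hβ0.le z)
    (fun z => by
      have hp : 0 < z ^ 2 + s₁ := by positivity
      have h1 := sq_add_rpow_neg_le hs₁ le_rfl hβ0.le z
      have h2 := sq_add_rpow_neg_le hs₁ le_rfl (show 0 ≤ β + 1 by linarith) z
      have e : (z ^ 2 + s₁) ^ (-β) = (z ^ 2 + s₁) * (z ^ 2 + s₁) ^ (-(β + 1)) := by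
        rw [show -β = 1 + -(β + 1) by ring, Real.rpow_add hp, Real.rpow_one]
      have h3 : 0 < (z ^ 2 + s₁) ^ (-(β + 1)) := by positivity
      rw [abs_of_pos (by positivity)] at h1
      rw [abs_of_pos h3] at h2
      rw [abs_mul, abs_of_pos h3, show -2 * β * z = β * (-2 * z) by ring, abs_mul,
        abs_of_pos hβ0, mul_assoc]
      refine mul_le_mul_of_nonneg_left ?_ hβ0.le
      have h4 : |-2 * z| ≤ (z ^ 2 + s₁) + 1 := by
        rw [abs_le]; constructor <;> nlinarith [sq_nonneg (z - 1), sq_nonneg (z + 1)]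
      calc |-2 * z| * (z ^ 2 + s₁) ^ (-(β + 1))
          ≤ ((z ^ 2 + s₁) + 1) * (z ^ 2 + s₁) ^ (-(β + 1)) := by gcongr
        _ ≤ _ := by rw [add_mul, ← e, one_mul]; linarith)
    (fun z => by
      refine (abs_sub _ _).trans ?_
      rw [abs_mul, abs_mul (4 * β * (β + 1) * s₁), abs_of_pos (by positivity),
        abs_of_pos (show 0 < 4 * β * (β + 1) * s₁ by positivity)]
      gcongr
      · exact sq_add_rpow_neg_le hs₁ le_rfl (by linarith) z
      · exact sq_add_rpow_neg_le hs₁ le_rfl (by linarith) z)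
    ((continuous_const.mul (continuous_sq_add_rpow hs₁ _)).sub
      (continuous_const.mul (continuous_sq_add_rpow hs₁ _)))
    (by positivity) hε
    (by
      simp only [kernelExtension_lineKernelFractional α u _ ht, ← mul_assoc] at hloc
      exact hloc)
  have hxx : ∫ y, w y * (2 * β * (2 * β + 1) * ((x - y) ^ 2 + s₁) ^ (-(β + 1)) -
      4 * β * (β + 1) * s₁ * ((x - y) ^ 2 + s₁) ^ (-(β + 2))) =
      2 * β * (2 * β + 1) * J (β + 1) s₁ - 4 * β * (β + 1) * s₁ * J (β + 2) s₁ := by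
    simp only [J, sqPotential]
    rw [← integral_const_mul, ← integral_const_mul, ← integral_sub
      ((integrable_mul_sq_add_rpow hw hs₁ (by linarith) x).const_mul _)
      ((integrable_mul_sq_add_rpow hw hs₁ (by linarith) x).const_mul _)]
    exact integral_congr_ae (Eventually.of_forall fun y => by ring)
  rw [hxx] at hx
  -- the temporal condition
  set W := fun s => a * J β s - β * (s * J (β + 1) s)
  have hJ : ∀ γ, 0 ≤ γ → ∀ s, 0 < s → HasDerivAt (J γ) (-γ * J (γ + 1) s) s :=
    fun γ hγ s hs => hasDerivAt_sqPotential hw hs hγ x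
  have hU : ∀ s, 0 < s → HasDerivAt (fun s => s ^ a * J β s) (s ^ (a - 1) * W s) s := by
    intro s hs
    have := (Real.hasDerivAt_rpow_const (x := s) (p := a) (Or.inl hs.ne')).fun_mul
      (hJ β hβ0.le s hs)
    refine this.congr_deriv ?_
    have e : s ^ a = s * s ^ (a - 1) := by
      rw [Real.rpow_sub_one hs.ne']; field_simp
    simp only [W]
    rw [e]; ring
  have hW : HasDerivAt W (a * (-β * J (β + 1) s₁) -
      β * (1 * J (β + 1) s₁ + s₁ * (-(β + 1) * J (β + 2) s₁))) s₁ := by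
    have h1 := hJ (β + 1) (by linarith) s₁ hs₁
    rw [show β + 1 + 1 = β + 2 by ring] at h1
    exact ((hJ β hβ0.le s₁ hs₁).const_mul a).fun_sub
      (((hasDerivAt_id' s₁).fun_mul h1).const_mul β)
  have hlm : IsLocalMax (fun s => s ^ a * J β s) s₁ := by
    filter_upwards [lt_mem_nhds hs₁] with s hs
    have h1 := hmax (Real.sqrt s) (Real.sqrt_pos.2 hs)
    rw [kernelExtension_lineKernelFractional α u x (Real.sqrt_pos.2 hs),
      kernelExtension_lineKernelFractional α u x ht, Real.sq_sqrt hs.le] at h1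
    exact le_of_mul_le_mul_left h1 hc
  have hW0 : W s₁ = 0 := by
    have := hlm.hasDerivAt_eq_zero (hU s₁ hs₁)
    exact (mul_eq_zero.1 this).resolve_left (by positivity)
  have h2 := hlm.second_deriv_nonpos ((lt_mem_nhds hs₁).mono fun s hs => hU s hs)
    ((Real.hasDerivAt_rpow_const (x := s₁) (p := a - 1) (Or.inl hs₁.ne')).fun_mul hW)
  rw [hW0, mul_zero, zero_add] at h2
  have h3 := nonpos_of_mul_nonpos_right h2 (show 0 < s₁ ^ (a - 1) by positivity)
  rw [hβa] at hx h3
  linarith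

theorem maxPrincipleKernel_fractional {α : ℝ} (hα1 : α < 1) :
    MaxPrincipleKernel (lineKernelFractional α) where
  continuous := by
    have h : Continuous fun x : ℝ => (x ^ 2 + 1) ^ ((2 - α) / 2) :=
      continuous_sq_add_rpow one_pos _
    exact continuous_const.mul (continuous_const.div h fun x => by positivity)
  nonneg x := by
    have := integral_fractional_pos hα1
    unfold lineKernelFractional
    positivity
  bounded := by
    refine ⟨(∫ y : ℝ, 1 / (y ^ 2 + 1) ^ ((2 - α) / 2))⁻¹, fun x => ?_⟩
    refine mul_le_of_le_one_right (inv_nonneg.2 (integral_fractional_pos hα1).le) ?_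
    rw [div_le_one (by positivity)]
    exact Real.one_le_rpow (by nlinarith [sq_nonneg x]) (by linarith)
  integrable := (integrable_fractional hα1).const_mul _
  integral_eq_one := by
    unfold lineKernelFractional
    rw [integral_const_mul]
    exact inv_mul_cancel₀ (integral_fractional_pos hα1).ne'
  not_isLocalMax hu _ _ ht hmax _ hε b := not_isLocalMax_lineKernelFractional hα1 hu ht hmax hε b

/-- The Poisson kernel is the case `α = 0` of the fractional one. -/
theorem lineKernelPoisson_eq : lineKernelPoisson = lineKernelFractional 0 := by
  have e : ∀ y : ℝ, 1 / (y ^ 2 + 1) ^ (((2 : ℝ) - 0) / 2) = (1 + y ^ 2)⁻¹ := fun y => by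
    rw [show ((2 : ℝ) - 0) / 2 = 1 by norm_num, Real.rpow_one, one_div, add_comm]
  funext x
  simp only [lineKernelPoisson, lineKernelFractional, e, integral_univ_inv_one_add_sq]
  rw [one_div, mul_inv, add_comm]

/-! ### The maximal operator on the Sobolev space -/

theorem kernelExtension_congr_ae (φ : ℝ → ℝ) {u v : ℝ → ℝ} (h : u =ᵐ[volume] v) :
    kernelExtension φ u = kernelExtension φ v := by
  funext x t
  rw [kernelExtension_eq, kernelExtension_eq]
  refine integral_congr_ae ?_
  filter_upwards [h] with y hy
  rw [hy]

theorem convMaximal_congr_ae (φ : ℝ → ℝ) {u v : ℝ → ℝ} (h : u =ᵐ[volume] v) :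
    convMaximal φ u = convMaximal φ v := by
  funext x
  rw [convMaximal, convMaximal, kernelExtension_congr_ae φ h]

namespace SobolevW11

theorem exists_rep (u : SobolevW11) :
    ∃ F : ℝ → ℝ, LocAC F ∧ (u.1.fst : ℝ → ℝ) =ᵐ[volume] F ∧
      (u.1.snd : ℝ → ℝ) =ᵐ[volume] deriv F :=
  IsWeakDeriv.exists_locAC u.2

/-- The absolutely continuous representative of an element of `W^{1,1}(ℝ)`. -/
noncomputable def rep (u : SobolevW11) : ℝ → ℝ := (exists_rep u).choose

theorem locAC_rep (u : SobolevW11) : LocAC (rep u) := (exists_rep u).choose_spec.1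

theorem sobolevFun_ae_eq_rep (u : SobolevW11) : sobolevFun u =ᵐ[volume] rep u :=
  (exists_rep u).choose_spec.2.1

theorem snd_ae_eq_deriv_rep (u : SobolevW11) :
    (u.1.snd : ℝ → ℝ) =ᵐ[volume] deriv (rep u) :=
  (exists_rep u).choose_spec.2.2

theorem integrable_rep (u : SobolevW11) : Integrable (rep u) :=
  (L1.integrable_coeFn u.1.fst).congr (sobolevFun_ae_eq_rep u)

theorem integrable_deriv_rep (u : SobolevW11) : Integrable (deriv (rep u)) :=
  (L1.integrable_coeFn u.1.snd).congr (snd_ae_eq_deriv_rep u)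

theorem abs_rep_le (u : SobolevW11) (x : ℝ) : |rep u x| ≤ ∫ t, |deriv (rep u) t| :=
  (locAC_rep u).abs_le_integral (integrable_rep u) (integrable_deriv_rep u) x

theorem integral_abs_deriv_rep_sub_le (u v : SobolevW11) :
    ∫ x, |deriv (rep u) x - deriv (rep v) x| ≤ ‖u - v‖ := by
  rw [norm_eq, L1.norm_eq_integral_norm (u - v).1.snd]
  refine le_trans (le_of_eq (integral_congr_ae ?_)) (le_add_of_nonneg_left (norm_nonneg _))
  filter_upwards [snd_ae_eq_deriv_rep u, snd_ae_eq_deriv_rep v,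
    Lp.coeFn_sub u.1.snd v.1.snd] with x h1 h2 h3
  have e : (u - v).1.snd = u.1.snd - v.1.snd := rfl
  rw [e, h3, Real.norm_eq_abs, Pi.sub_apply, h1, h2]

theorem abs_rep_sub_le (u v : SobolevW11) (x : ℝ) : |rep u x - rep v x| ≤ ‖u - v‖ := by
  have hac := (locAC_rep u).sub (locAC_rep v)
  have hae : deriv (fun x => rep u x - rep v x) =ᵐ[volume]
      fun x => deriv (rep u) x - deriv (rep v) x := by
    filter_upwards [(locAC_rep u).ae_differentiableAt, (locAC_rep v).ae_differentiableAt]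
      with y h1 h2
    exact deriv_fun_sub h1 h2
  have h := hac.abs_le_integral ((integrable_rep u).sub (integrable_rep v))
    (((integrable_deriv_rep u).sub (integrable_deriv_rep v)).congr hae.symm) x
  refine h.trans (le_trans (le_of_eq (integral_congr_ae ?_)) (integral_abs_deriv_rep_sub_le u v))
  filter_upwards [hae] with y hy
  rw [hy]

variable {φ : ℝ → ℝ}

theorem convexlyDetached (hφ : MaxPrincipleKernel φ) (u : SobolevW11) :
    ConvexlyDetached (convMaximal φ (rep u)) (fun x => |rep u x|) :=
  hφ.convexlyDetached ((locAC_rep u).uniformContinuous (integrable_deriv_rep u))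
    (integrable_rep u) (abs_rep_le u)

theorem locAC_convMaximal (hφ : MaxPrincipleKernel φ) (u : SobolevW11) :
    LocAC (convMaximal φ (rep u)) ∧ Integrable (deriv (convMaximal φ (rep u))) := by
  have huc := (locAC_rep u).uniformContinuous (integrable_deriv_rep u)
  refine (convexlyDetached hφ u).locAC (hφ.continuous_convMaximal huc (abs_rep_le u))
    (locAC_rep u).abs ((locAC_rep u).integrable_deriv_abs (integrable_deriv_rep u))
    (B := ∫ t, |deriv (rep u) t|) fun x => ?_
  have : convMaximal φ (rep u) x ≤ ∫ t, |deriv (rep u) t| :=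
    MaxPrincipleKernel.convMaximal_le fun t ht =>
      hφ.kernelExtension_le huc.continuous (abs_rep_le u) x ht
  linarith [abs_nonneg (rep u x)]

theorem abs_convMaximal_sub_le (hφ : MaxPrincipleKernel φ) (u v : SobolevW11) (x : ℝ) :
    |convMaximal φ (rep u) x - convMaximal φ (rep v) x| ≤ ‖u - v‖ :=
  hφ.abs_convMaximal_sub_le (locAC_rep u).continuous (locAC_rep v).continuous
    (fun z => (abs_rep_le u z).trans (le_max_left _ _))
    (fun z => (abs_rep_le v z).trans (le_max_right _ _)) fun _ => abs_rep_sub_le u v _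

/-- The derivative of the maximal function, as an element of `L¹(ℝ)`. -/
noncomputable def derivMaximal (hφ : MaxPrincipleKernel φ) (u : SobolevW11) : ℝ →₁[volume] ℝ :=
  (locAC_convMaximal hφ u).2.toL1 _

theorem continuous_derivMaximal (hφ : MaxPrincipleKernel φ) : Continuous (derivMaximal hφ) := by
  rw [Metric.continuous_iff]
  intro u ε hε
  have hu := locAC_convMaximal hφ u
  have hau := (locAC_rep u).abs
  have hdu := (locAC_rep u).integrable_deriv_abs (integrable_deriv_rep u)
  obtain ⟨ρ, hρ, h⟩ := (convexlyDetached hφ u).exists_integral_abs_deriv_sub_le hu.1 hau hu.2 hdu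
    (show 0 < ε / 2 by linarith)
  obtain ⟨r, hr, h'⟩ := (locAC_rep u).exists_integral_abs_deriv_abs_sub_le
    (integrable_deriv_rep u) hρ
  refine ⟨min ρ r, lt_min hρ hr, fun v hv => ?_⟩
  rw [dist_eq_norm] at hv
  have h1 : ‖v - u‖ ≤ ρ := hv.le.trans (min_le_left _ _)
  have h2 : ‖v - u‖ ≤ r := hv.le.trans (min_le_right _ _)
  have hv' := locAC_convMaximal hφ v
  have key := h _ _ (convexlyDetached hφ v) hv'.1 (locAC_rep v).abs hv'.2
    ((locAC_rep v).integrable_deriv_abs (integrable_deriv_rep v))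
    (fun x => (abs_convMaximal_sub_le hφ v u x).trans h1)
    (fun x => ((abs_abs_sub_abs_le_abs_sub _ _).trans (abs_rep_sub_le v u x)).trans h1)
    (h' _ (locAC_rep v) (integrable_deriv_rep v) (fun x => (abs_rep_sub_le v u x).trans h2)
      ((integral_abs_deriv_rep_sub_le v u).trans h2))
  rw [dist_eq_norm, derivMaximal, derivMaximal, ← Integrable.toL1_sub,
    L1.norm_of_fun_eq_integral_norm]
  calc _ ≤ ε / 2 := key
    _ < ε := by linarith

end SobolevW11

end

theorem theorem1 (φ : ℝ → ℝ)
    (hφ : φ = lineKernelPoisson ∨ φ = lineKernelHeat ∨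
      ∃ α : ℝ, 0 < α ∧ α < 1 ∧ φ = lineKernelFractional α) :
    (∀ (u : SobolevW11) (x : ℝ),
      (∀ t : ℝ, 0 < t → ConvolutionExistsAt (fun y => |sobolevFun u y|) (dilatedKernel φ t) x
        (ContinuousLinearMap.lsmul ℝ ℝ) volume) ∧
      BddAbove (kernelExtension φ (sobolevFun u) x '' Set.Ioi 0)) ∧
    ∃ T : SobolevW11 → (ℝ →₁[volume] ℝ),
      (∀ u : SobolevW11, IsWeakDeriv (convMaximal φ (sobolevFun u)) (T u)) ∧ Continuous T := by
  have hφ' : MaxPrincipleKernel φ := by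
    rcases hφ with rfl | rfl | ⟨α, -, hα, rfl⟩
    · rw [lineKernelPoisson_eq]
      exact maxPrincipleKernel_fractional zero_lt_one
    · exact maxPrincipleKernel_heat
    · exact maxPrincipleKernel_fractional hα
  refine ⟨fun u x => ⟨fun t _ => ?_, ?_⟩, SobolevW11.derivMaximal hφ', fun u => ?_,
    SobolevW11.continuous_derivMaximal hφ'⟩
  · exact hφ'.integrable_mul_dilatedKernel (L1.integrable_coeFn u.1.fst).abs x t
  · rw [kernelExtension_congr_ae φ (SobolevW11.sobolevFun_ae_eq_rep u)]
    exact hφ'.bddAbove (SobolevW11.locAC_rep u).continuous (SobolevW11.abs_rep_le u) x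
  · rw [convMaximal_congr_ae φ (SobolevW11.sobolevFun_ae_eq_rep u)]
    exact (SobolevW11.locAC_convMaximal hφ' u).1.isWeakDeriv.congr (Filter.EventuallyEq.refl _ _)
      (Integrable.coeFn_toL1 _).symm
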